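/- Let $(v_i)_{i\in\mathbb Z}$ be i.i.d. real random variables whose common distribution $\mathbb P$ has mean $0$, variance $1$ and support bounded by $c_0$ (that is, $|v_i|\le c_0$ almost surely), and consider for $0<\sigma\le 1$ the one-dimensional Anderson model $H_\omega=H_0+\sigma V_\omega$ on $\ell^2(\mathbb Z)$, where $(H_0\psi)(i)=\psi(i-1)+\psi(i+1)$ and $(V_\omega\psi)(i)=v_i\psi(i)$. Let $H_{\omega,n}$ be the restriction of $H_\omega$ to the box $\{1,\dots,n\}$, i.e. the $n\times n$ matrix with entries $\sigma v_1,\dots,\sigma v_n$ on the diagonal, $1$ next to the diagonal and $0$ elsewhere. The integrated density of states (IDS) $\mu_\sigma$ is the nonrandom probability measure on $\mathbb R$ to which, almost surely, the empirical eigenvalue distributions $\frac1n\sum_{j=1}^n\delta_{\lambda_j(H_{\omega,n})}$ converge weakly as $n\to\infty$. This limit exists, and for every $\gamma>0$ the following hold. (1) For all $\lambda_0\in(-2+\gamma,-\gamma)\cup(\gamma,2-\gamma)$ and all $0<\lambda\le 1$, $$\mu_\sigma[\lambda_0,\lambda_0+\lambda]\le\frac{2}{\sigma^3}\,\lambda^{\,1-460\,c_0^3\,\sigma/\gamma}.$$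 (2) If $\alpha:=1-460\,c_0^3\,\sigma/\gamma\ge 0$, then the distribution function $E\mapsto\mu_\sigma(-\infty,E]$ is Hölder continuous with exponent $\alpha$ on $(-2+\gamma,-\gamma)\cup(\gamma,2-\gamma)$. -/

import Mathlib

open MeasureTheory ProbabilityTheory Filter Topology
open scoped ENNReal NNReal BoundedContinuousFunction

/-- The bi-infinite matrix, in the standard basis of `ℓ²(ℤ)`, of the one-dimensional Schrödinger
operator `H₀ + σ V`: ones next to the diagonal and `σ v i` at the diagonal entry `(i, i)`. -/
def andersonMatrix (σ : ℝ) (v : ℤ → ℝ) : Matrix ℤ ℤ ℝ :=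
  fun i j => if i = j then σ * v i else if |i - j| = 1 then 1 else 0

/-- The restriction of `H₀ + σ V` to the finite box `{1, …, n}`. -/
def boxMatrix (σ : ℝ) (v : ℤ → ℝ) (n : ℕ) : Matrix (Fin n) (Fin n) ℝ :=
  (andersonMatrix σ v).submatrix (fun i => (i : ℤ) + 1) (fun i => (i : ℤ) + 1)

theorem boxMatrix_isHermitian (σ : ℝ) (v : ℤ → ℝ) (n : ℕ) : (boxMatrix σ v n).IsHermitian := by
  ext i j
  simp only [boxMatrix, andersonMatrix, Matrix.conjTranspose_apply, Matrix.submatrix_apply,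
    star_trivial, abs_sub_comm ((j : ℤ) + 1) ((i : ℤ) + 1), eq_comm (a := (j : ℤ) + 1)]
  split_ifs with h <;> simp [h]

/-- The empirical eigenvalue distribution `(1/n) ∑ δ_{λᵢ}` of the box operator, where `λ₁, …, λₙ`
are its eigenvalues listed with multiplicity. -/
noncomputable def empiricalEigenvalueMeasure (σ : ℝ) (v : ℤ → ℝ) (n : ℕ) : Measure ℝ :=
  (n : ℝ≥0∞)⁻¹ • ∑ i : Fin n, Measure.dirac ((boxMatrix_isHermitian σ v n).eigenvalues i)

/-- `μ` is the integrated density of states (as a measure) of the random operator `H₀ + σ V`, with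
random potential `v`: it is the nonrandom probability measure to which, almost surely, the empirical
eigenvalue distributions of the restrictions to the boxes `{1, …, n}` converge weakly. -/
def IsIntegratedDensityOfStates {Ω : Type*} [MeasurableSpace Ω] (Pr : Measure Ω)
    (v : ℤ → Ω → ℝ) (σ : ℝ) (μ : Measure ℝ) : Prop :=
  IsProbabilityMeasure μ ∧
    ∀ᵐ ω ∂Pr, ∀ f : ℝ →ᵇ ℝ,
      Tendsto (fun n : ℕ => ∫ x, f x ∂(empiricalEigenvalueMeasure σ (fun i => v i ω) n))
        atTop (𝓝 (∫ x, f x ∂μ))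

/-! # Hölder continuity of the integrated density of states at weak disorder

Fix an energy `a = 2 cos k` away from `0` and `±2`, a nearby energy `a + d`, and the solutions `p`, `q`
of the difference equation at these energies with `ψ(0) = 0`, `ψ(1) = 1`.

*Counting.* Completing squares, with the ratios `p(j+1) / p(j)` as pivots, shows that the number of
eigenvalues of the box matrix in `(a, a + d)` is bounded by the difference of the numbers of `j` with
`q(j+1) q(j) > 0` and with `p(j+1) p(j) > 0` (`card_eigenvalues_Ioo_le`). In the coordinate
`z_j = ψ(j+1) - e^{-ik} ψ(j)` of the plane, one step of the recursion at energy `a` is the rotation by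
`e^{ik}` followed by a shear of size `σ v / sin k` (`solVec_succ`). The two counts can drift apart only
at sites where the inner product of the two solution vectors changes sign (`sum_ite_sub_ite_le`), and
there the vectors are almost orthogonal. So the mass of the interval is bounded by the frequency with
which the angle between the vectors is of order one. The solutions have no zeros for almost every
energy, so the ends of the interval can be chosen generic (`ae_ae_sol_ne_zero`).

*Contraction.* Both vectors start in the same direction. Being sheared by nearly the same amount, they
stay nearly parallel: the sine of their angle changes by the inverse of the product of their length
distortions, and by at most `d / sin k` because of the energy difference (`sinAngle_shear_le`). For a
power `2r < 1` of the sine, the average over `v` of the relative change is, to second order, a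
rotation-invariant part at most `-(σ / sin k)² r (1 - 2r) / 2` plus terms that oscillate with the phases of the vectors.
The oscillating terms are coboundaries for the rotation, with small denominators `1 - e^{-2ik}` and
`1 - e^{-4ik}` that are controlled by the distance of `a` from `±2` and `0`; they are removed by
multiplying with the exponential of a corrector. The third-order errors are a multiple of
`(σ / sin k)² c₀³ σ / γ`, so the choice `2r = 1 - 230 c₀³ σ / γ` leaves a definite contraction
(`integral_lyapunov_step_le`, `gain_le`). Independence of the next potential value then bounds
the expected power of the sine, uniformly in the site, by a multiple of `d^{2r}` divided by the rate of
contraction (`integral_lyapunov_solVec_le`), and Fatou's lemma carries the bound to the limit measure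
(`integral_le_of_lyapunov_bound`).

*Existence.* The moments of the empirical distributions are, up to boundary terms, averages of local
functions of the potential, so they converge almost surely by the strong law of large numbers. All the
measures live on one compact interval, where moments determine weak limits
(`MomentConvergence.exists_limit`).
-/

/-! ### Shears and doubled phases -/

/-- The shear `x + iy ↦ (x - t y) + iy` of the plane `ℂ = ℝ²`. -/
def shear (t : ℝ) (u : ℂ) : ℂ := u - ((t * u.im : ℝ) : ℂ)

/-- The doubled phase `z / z̄ = e^{2iθ}` of a nonzero vector `z = |z| e^{iθ}`. -/
noncomputable def phase (z : ℂ) : ℂ := z / (starRingEnd ℂ) z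

/-- The sine of the unoriented angle between the lines spanned by two plane vectors. -/
noncomputable def sinAngle (x y : ℂ) : ℝ := |((starRingEnd ℂ) x * y).im| / (‖x‖ * ‖y‖)

@[simp] lemma shear_re (t : ℝ) (u : ℂ) : (shear t u).re = u.re - t * u.im := by simp [shear]

@[simp] lemma shear_im (t : ℝ) (u : ℂ) : (shear t u).im = u.im := by simp [shear]

lemma shear_ne_zero (t : ℝ) {u : ℂ} (hu : u ≠ 0) : shear t u ≠ 0 := by
  intro h
  apply hu
  have h1 := congrArg Complex.im h
  have h2 := congrArg Complex.re h
  simp at h1 h2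
  apply Complex.ext
  · simpa [h1] using h2
  · simpa using h1

lemma norm_phase {z : ℂ} (hz : z ≠ 0) : ‖phase z‖ = 1 := by
  rw [phase, norm_div, RCLike.norm_conj, div_self (norm_ne_zero_iff.mpr hz)]

lemma norm_phase_le_one (z : ℂ) : ‖phase z‖ ≤ 1 := by
  by_cases hz : z = 0
  · simp [phase, hz]
  · exact (norm_phase hz).le

lemma phase_re (z : ℂ) : (phase z).re = (z.re ^ 2 - z.im ^ 2) / (z.re ^ 2 + z.im ^ 2) := by
  simp [phase, Complex.div_re, Complex.normSq_apply]
  ring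

lemma phase_im (z : ℂ) : (phase z).im = 2 * z.re * z.im / (z.re ^ 2 + z.im ^ 2) := by
  simp [phase, Complex.div_im, Complex.normSq_apply]
  ring

lemma re_sq_add_im_sq_pos {z : ℂ} (hz : z ≠ 0) : 0 < z.re ^ 2 + z.im ^ 2 := by
  have := Complex.normSq_pos.mpr hz
  rw [Complex.normSq_apply] at this
  nlinarith

lemma phase_re_sq_add_im_sq {z : ℂ} (hz : z ≠ 0) : (phase z).re ^ 2 + (phase z).im ^ 2 = 1 := by
  have := (re_sq_add_im_sq_pos hz).ne'
  rw [phase_re, phase_im]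
  field_simp
  ring

lemma phase_mul {ζ : ℂ} (hζ : ‖ζ‖ = 1) (z : ℂ) : phase (ζ * z) = ζ ^ 2 * phase z := by
  have h : (starRingEnd ℂ) ζ = ζ⁻¹ := by
    rw [Complex.inv_def, Complex.normSq_eq_norm_sq, hζ]; simp
  rw [phase, phase, map_mul, h, mul_div_mul_comm, div_inv_eq_mul]
  ring

/-- Squared length distortion of a shear, as a function of the doubled phase. -/
noncomputable def shearFactor (t : ℝ) (w : ℂ) : ℝ := 1 - t * w.im + t ^ 2 * ((1 - w.re) / 2)

lemma norm_shear_sq (t : ℝ) {u : ℂ} (hu : u ≠ 0) :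
    ‖shear t u‖ ^ 2 = ‖u‖ ^ 2 * shearFactor t (phase u) := by
  have := (re_sq_add_im_sq_pos hu).ne'
  rw [← Complex.normSq_eq_norm_sq, ← Complex.normSq_eq_norm_sq, Complex.normSq_apply,
    Complex.normSq_apply, shearFactor, phase_re, phase_im, shear_re, shear_im]
  field_simp
  ring

lemma abs_re_im_le_one {w : ℂ} (hw : ‖w‖ ≤ 1) : |w.re| ≤ 1 ∧ |w.im| ≤ 1 :=
  ⟨(Complex.abs_re_le_norm w).trans hw, (Complex.abs_im_le_norm w).trans hw⟩

lemma abs_shearFactor_sub_one_le {t : ℝ} (ht : |t| ≤ 1 / 100) {w : ℂ} (hw : ‖w‖ ≤ 1) :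
    |shearFactor t w - 1| ≤ 1.01 * |t| := by
  obtain ⟨h1, h2⟩ := abs_re_im_le_one hw
  have h3 : |(1 - w.re) / 2| ≤ 1 := by rw [abs_le] at *; constructor <;> linarith
  have h4 : |t * w.im| ≤ |t| := by
    rw [abs_mul]; exact mul_le_of_le_one_right (abs_nonneg _) h2
  have h5 : |t ^ 2 * ((1 - w.re) / 2)| ≤ 1 / 100 * |t| := by
    rw [abs_mul, abs_pow]
    calc |t| ^ 2 * |(1 - w.re) / 2| ≤ |t| ^ 2 * 1 := by gcongr
      _ = |t| * |t| := by ring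
      _ ≤ 1 / 100 * |t| := by gcongr
  have : shearFactor t w - 1 = -(t * w.im) + t ^ 2 * ((1 - w.re) / 2) := by
    rw [shearFactor]; ring
  rw [this]
  refine (abs_add_le _ _).trans ?_
  rw [abs_neg]
  linarith

/-- Second-order expansion of the logarithm of the squared length distortion. -/
lemma abs_log_shearFactor_sub_le {t : ℝ} (ht : |t| ≤ 1 / 100) {w : ℂ} (hw : ‖w‖ ≤ 1) :
    |Real.log (shearFactor t w) -
      (-(t * w.im) + t ^ 2 * ((1 - w.re) / 2 - w.im ^ 2 / 2))| ≤ 3 * |t| ^ 3 := by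
  obtain ⟨h1, h2⟩ := abs_re_im_le_one hw
  set y := shearFactor t w - 1 with hy
  have hyt : |y| ≤ 1.01 * |t| := abs_shearFactor_sub_one_le ht hw
  have ht0 := abs_nonneg t
  have hy1 : |y| ≤ 0.02 := by linarith
  have hlog := Real.abs_log_sub_add_sum_range_le (x := -y) (by rw [abs_neg]; linarith) 2
  rw [abs_neg] at hlog
  simp only [Finset.sum_range_succ, Finset.sum_range_zero] at hlog
  norm_num at hlog
  have h1y : 1 + y = shearFactor t w := by rw [hy]; ring
  rw [h1y] at hlog
  have hb : |y| ^ 3 / (1 - |y|) ≤ 1.2 * |t| ^ 3 := by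
    rw [div_le_iff₀ (by linarith)]
    have : |y| ^ 3 ≤ (1.01 * |t|) ^ 3 := by gcongr
    have h3 : 0 ≤ |t| ^ 3 := by positivity
    nlinarith
  have hz : |t ^ 3 * (w.im * ((1 - w.re) / 2)) - t ^ 4 * (((1 - w.re) / 2) ^ 2 / 2)|
      ≤ 1.1 * |t| ^ 3 := by
    have h3 : |(1 - w.re) / 2| ≤ 1 := by rw [abs_le] at *; constructor <;> linarith
    have h5 : |((1 - w.re) / 2) ^ 2 / 2| ≤ 1 := by
      rw [abs_div, abs_pow, abs_of_pos (by norm_num : (0:ℝ) < 2)]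
      have : |(1 - w.re) / 2| ^ 2 ≤ 1 := pow_le_one₀ (abs_nonneg _) h3
      linarith
    calc _ ≤ |t ^ 3 * (w.im * ((1 - w.re) / 2))| + |t ^ 4 * (((1 - w.re) / 2) ^ 2 / 2)| :=
          abs_sub _ _
      _ = |t| ^ 3 * (|w.im| * |(1 - w.re) / 2|) + |t| ^ 3 * |t| * |((1 - w.re) / 2) ^ 2 / 2| := by
          rw [abs_mul, abs_mul, abs_mul, abs_pow, abs_pow]; ring
      _ ≤ |t| ^ 3 * (1 * 1) + |t| ^ 3 * (1 / 100) * 1 := by gcongr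
      _ ≤ _ := by nlinarith [pow_nonneg ht0 3]
  have hid : Real.log (shearFactor t w) -
      (-(t * w.im) + t ^ 2 * ((1 - w.re) / 2 - w.im ^ 2 / 2)) =
      (-y + y ^ 2 / 2 + Real.log (shearFactor t w)) +
      (t ^ 3 * (w.im * ((1 - w.re) / 2)) - t ^ 4 * (((1 - w.re) / 2) ^ 2 / 2)) := by
    rw [hy, shearFactor]; ring
  rw [hid]
  refine (abs_add_le _ _).trans ?_
  have := pow_nonneg ht0 3
  linarith

lemma norm_shear_sub_le (t : ℝ) (u : ℂ) : ‖shear t u - u‖ ≤ |t| * ‖u‖ := by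
  rw [shear, sub_sub_cancel_left, norm_neg, Complex.norm_real, Real.norm_eq_abs, abs_mul]
  gcongr
  exact Complex.abs_im_le_norm u

lemma norm_phase_shear_sub_le {t : ℝ} (ht : |t| ≤ 1 / 100) {u : ℂ} (hu : u ≠ 0) :
    ‖phase (shear t u) - phase u‖ ≤ 2.1 * |t| := by
  have hs := shear_ne_zero t hu
  have hc : (starRingEnd ℂ) u ≠ 0 := by simpa using hu
  have hcs : (starRingEnd ℂ) (shear t u) ≠ 0 := by simpa using hs
  have hd := norm_shear_sub_le t u
  set d := shear t u - u with hdd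
  have hid : phase (shear t u) - phase u =
      (d * (starRingEnd ℂ) u - u * (starRingEnd ℂ) d) /
        ((starRingEnd ℂ) (shear t u) * (starRingEnd ℂ) u) := by
    rw [phase, phase, div_sub_div _ _ hcs hc, hdd, map_sub]
    ring
  have hup : 0 < ‖u‖ := norm_pos_iff.mpr hu
  have hlow : 0.99 * ‖u‖ ≤ ‖shear t u‖ := by
    have : ‖u‖ ≤ ‖shear t u‖ + ‖d‖ := by
      have := norm_sub_norm_le u (shear t u)
      rw [norm_sub_rev] at this
      linarith
    nlinarith
  rw [hid, norm_div, norm_mul, RCLike.norm_conj, RCLike.norm_conj,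
    div_le_iff₀ (by positivity)]
  calc _ ≤ ‖d * (starRingEnd ℂ) u‖ + ‖u * (starRingEnd ℂ) d‖ := norm_sub_le _ _
    _ = 2 * ‖d‖ * ‖u‖ := by rw [norm_mul, norm_mul, RCLike.norm_conj, RCLike.norm_conj]; ring
    _ ≤ 2 * (|t| * ‖u‖) * ‖u‖ := by gcongr
    _ ≤ 2.1 * |t| * (0.99 * ‖u‖ * ‖u‖) := by
        have : 0 ≤ |t| * (‖u‖ * ‖u‖) := by positivity
        nlinarith
    _ ≤ _ := by gcongr

/-! ### The corrector -/

/-- A trigonometric polynomial in two doubled phases: `A` multiplies its part of degree one, `-B` its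
part of degree two. With `A = B = 1` its real part is the oscillating part of the second-order term
(`second_order_eq`). Separate coefficients are kept because a common rotation by `ζ` multiplies the
two parts by the different factors `ζ²` and `ζ⁴`. -/
noncomputable def trigPoly (r : ℝ) (A B w₁ w₂ : ℂ) : ℂ :=
  A * ((r / 2 : ℝ) * (w₁ + w₂)) -
    B * (((r + r ^ 2) / 4 : ℝ) * (w₁ ^ 2 + w₂ ^ 2) + (r ^ 2 / 2 : ℝ) * (w₁ * w₂))

/-- The corrector: the solution of the cohomological equation for the rotation by `ζ` whose
right-hand side is the oscillating part of the second-order term. The inverses are meaningful when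
`ζ² ≠ 1` and `ζ⁴ ≠ 1`, that is, when the energy `2 Re ζ` is neither `±2` nor `0`. -/
noncomputable def corrector (r : ℝ) (ζ w₁ w₂ : ℂ) : ℝ :=
  (trigPoly r (-(1 - (starRingEnd ℂ) ζ ^ 2)⁻¹) (-(1 - (starRingEnd ℂ) ζ ^ 4)⁻¹) w₁ w₂).re

lemma corrector_rotate_sub (r : ℝ) {ζ : ℂ} (hζ : ‖ζ‖ = 1)
    (h2 : 1 - (starRingEnd ℂ) ζ ^ 2 ≠ 0) (h4 : 1 - (starRingEnd ℂ) ζ ^ 4 ≠ 0) (w₁ w₂ : ℂ) :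
    corrector r ζ (ζ ^ 2 * w₁) (ζ ^ 2 * w₂) - corrector r ζ w₁ w₂ =
      -(trigPoly r 1 1 (ζ ^ 2 * w₁) (ζ ^ 2 * w₂)).re := by
  have hc : (starRingEnd ℂ) ζ * ζ = 1 := by
    rw [mul_comm, Complex.mul_conj, Complex.normSq_eq_norm_sq, hζ]; simp
  rw [corrector, corrector, ← Complex.sub_re, ← Complex.neg_re]
  congr 1
  set c := (starRingEnd ℂ) ζ
  set A := (1 - c ^ 2)⁻¹ with hA
  set B := (1 - c ^ 4)⁻¹ with hB
  have hA' : A * (1 - c ^ 2) = 1 := inv_mul_cancel₀ h2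
  have hB' : B * (1 - c ^ 4) = 1 := inv_mul_cancel₀ h4
  obtain ⟨W₁, hW₁⟩ : ∃ W, W = ζ ^ 2 * w₁ := ⟨_, rfl⟩
  obtain ⟨W₂, hW₂⟩ : ∃ W, W = ζ ^ 2 * w₂ := ⟨_, rfl⟩
  have e1 : w₁ = c ^ 2 * W₁ := by
    rw [hW₁, ← mul_assoc, ← mul_pow, hc, one_pow, one_mul]
  have e2 : w₂ = c ^ 2 * W₂ := by
    rw [hW₂, ← mul_assoc, ← mul_pow, hc, one_pow, one_mul]
  rw [← hW₁, ← hW₂, e1, e2]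
  simp only [trigPoly]
  linear_combination (-((r / 2 : ℝ) : ℂ) * (W₁ + W₂)) * hA' +
    ((((r + r ^ 2) / 4 : ℝ) : ℂ) * (W₁ ^ 2 + W₂ ^ 2) + ((r ^ 2 / 2 : ℝ) : ℂ) * (W₁ * W₂)) * hB'

lemma norm_neg_inv_le {c g : ℝ} (hg : 0 < g) (hc : 0 < c) {z : ℂ} (hz : c * g ≤ ‖z‖) :
    ‖-z⁻¹‖ ≤ 1 / c / g := by
  rw [norm_neg, norm_inv, div_div, ← one_div]
  exact one_div_le_one_div_of_le (by positivity) hz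

lemma abs_corrector_le {r g : ℝ} (hr0 : 0 ≤ r) (hr : r ≤ 1 / 2) (hg : 0 < g) {ζ w₁ w₂ : ℂ}
    (h2 : g ≤ ‖1 - (starRingEnd ℂ) ζ ^ 2‖) (h4 : 2 * g ≤ ‖1 - (starRingEnd ℂ) ζ ^ 4‖)
    (hw₁ : ‖w₁‖ ≤ 1) (hw₂ : ‖w₂‖ ≤ 1) : |corrector r ζ w₁ w₂| ≤ 0.75 / g := by
  have hA := norm_neg_inv_le hg one_pos (by rwa [one_mul] : 1 * g ≤ _)
  have hB := norm_neg_inv_le hg two_pos h4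
  rw [corrector]
  refine (Complex.abs_re_le_norm _).trans ?_
  rw [trigPoly]
  set A := -(1 - (starRingEnd ℂ) ζ ^ 2)⁻¹
  set B := -(1 - (starRingEnd ℂ) ζ ^ 4)⁻¹
  have n1 : ‖((r / 2 : ℝ) : ℂ)‖ ≤ 1 / 4 := by
    rw [Complex.norm_real, Real.norm_eq_abs, abs_of_nonneg (by positivity)]; linarith
  have n2 : ‖(((r + r ^ 2) / 4 : ℝ) : ℂ)‖ ≤ 3 / 16 := by
    rw [Complex.norm_real, Real.norm_eq_abs, abs_of_nonneg (by positivity)]; nlinarith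
  have n3 : ‖((r ^ 2 / 2 : ℝ) : ℂ)‖ ≤ 1 / 8 := by
    rw [Complex.norm_real, Real.norm_eq_abs, abs_of_nonneg (by positivity)]; nlinarith
  have m1 : ‖w₁ + w₂‖ ≤ 2 := (norm_add_le _ _).trans (by linarith)
  have m2 : ‖w₁ ^ 2 + w₂ ^ 2‖ ≤ 2 := by
    refine (norm_add_le _ _).trans ?_
    rw [norm_pow, norm_pow]
    nlinarith [pow_le_one₀ (n := 2) (norm_nonneg w₁) hw₁, pow_le_one₀ (n := 2) (norm_nonneg w₂) hw₂]
  have m3 : ‖w₁ * w₂‖ ≤ 1 := by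
    rw [norm_mul]; exact mul_le_one₀ hw₁ (norm_nonneg _) hw₂
  calc _ ≤ ‖A‖ * (‖((r / 2 : ℝ) : ℂ)‖ * ‖w₁ + w₂‖) + ‖B‖ * (‖(((r + r ^ 2) / 4 : ℝ) : ℂ)‖ *
        ‖w₁ ^ 2 + w₂ ^ 2‖ + ‖((r ^ 2 / 2 : ℝ) : ℂ)‖ * ‖w₁ * w₂‖) := by
        refine (norm_sub_le _ _).trans ?_
        rw [norm_mul, norm_mul, norm_mul]
        gcongr
        refine (norm_add_le _ _).trans ?_
        rw [norm_mul, norm_mul]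
    _ ≤ 1 / 1 / g * (1 / 4 * 2) + 1 / 2 / g * (3 / 16 * 2 + 1 / 8 * 1) := by gcongr
    _ = 0.75 / g := by field_simp; norm_num

lemma abs_corrector_sub_le {r g : ℝ} (hr0 : 0 ≤ r) (hr : r ≤ 1 / 2) (hg : 0 < g)
    {ζ w₁ w₂ w₁' w₂' : ℂ}
    (h2 : g ≤ ‖1 - (starRingEnd ℂ) ζ ^ 2‖) (h4 : 2 * g ≤ ‖1 - (starRingEnd ℂ) ζ ^ 4‖)
    (hw₁ : ‖w₁‖ ≤ 1) (hw₂ : ‖w₂‖ ≤ 1) (hw₁' : ‖w₁'‖ ≤ 1) (hw₂' : ‖w₂'‖ ≤ 1) :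
    |corrector r ζ w₁' w₂' - corrector r ζ w₁ w₂| ≤ (‖w₁' - w₁‖ + ‖w₂' - w₂‖) * (0.5 / g) := by
  have hA := norm_neg_inv_le hg one_pos (by rwa [one_mul] : 1 * g ≤ _)
  have hB := norm_neg_inv_le hg two_pos h4
  rw [corrector, corrector, ← Complex.sub_re]
  refine (Complex.abs_re_le_norm _).trans ?_
  rw [trigPoly, trigPoly]
  set A := -(1 - (starRingEnd ℂ) ζ ^ 2)⁻¹
  set B := -(1 - (starRingEnd ℂ) ζ ^ 4)⁻¹
  have n1 : ‖((r / 2 : ℝ) : ℂ)‖ ≤ 1 / 4 := by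
    rw [Complex.norm_real, Real.norm_eq_abs, abs_of_nonneg (by positivity)]; linarith
  have n2 : ‖(((r + r ^ 2) / 4 : ℝ) : ℂ)‖ ≤ 3 / 16 := by
    rw [Complex.norm_real, Real.norm_eq_abs, abs_of_nonneg (by positivity)]; nlinarith
  have n3 : ‖((r ^ 2 / 2 : ℝ) : ℂ)‖ ≤ 1 / 8 := by
    rw [Complex.norm_real, Real.norm_eq_abs, abs_of_nonneg (by positivity)]; nlinarith
  set δ₁ := ‖w₁' - w₁‖
  set δ₂ := ‖w₂' - w₂‖
  have s1 : ‖w₁' + w₁‖ ≤ 2 := (norm_add_le _ _).trans (by linarith)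
  have s2 : ‖w₂' + w₂‖ ≤ 2 := (norm_add_le _ _).trans (by linarith)
  have m1 : ‖(w₁' - w₁) + (w₂' - w₂)‖ ≤ δ₁ + δ₂ := norm_add_le _ _
  have m2 : ‖(w₁' - w₁) * (w₁' + w₁) + (w₂' - w₂) * (w₂' + w₂)‖ ≤ δ₁ * 2 + δ₂ * 2 := by
    refine (norm_add_le _ _).trans ?_
    rw [norm_mul, norm_mul]
    gcongr
  have m3 : ‖(w₁' - w₁) * w₂' + w₁ * (w₂' - w₂)‖ ≤ δ₁ * 1 + 1 * δ₂ := by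
    refine (norm_add_le _ _).trans ?_
    rw [norm_mul, norm_mul]
    gcongr
  have hid : A * ((r / 2 : ℝ) * (w₁' + w₂')) -
      B * (((r + r ^ 2) / 4 : ℝ) * (w₁' ^ 2 + w₂' ^ 2) + (r ^ 2 / 2 : ℝ) * (w₁' * w₂')) -
      (A * ((r / 2 : ℝ) * (w₁ + w₂)) -
      B * (((r + r ^ 2) / 4 : ℝ) * (w₁ ^ 2 + w₂ ^ 2) + (r ^ 2 / 2 : ℝ) * (w₁ * w₂))) =
      A * ((r / 2 : ℝ) * ((w₁' - w₁) + (w₂' - w₂))) - B * (((r + r ^ 2) / 4 : ℝ) *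
        ((w₁' - w₁) * (w₁' + w₁) + (w₂' - w₂) * (w₂' + w₂)) + (r ^ 2 / 2 : ℝ) *
        ((w₁' - w₁) * w₂' + w₁ * (w₂' - w₂))) := by ring
  rw [hid]
  calc _ ≤ ‖A‖ * (‖((r / 2 : ℝ) : ℂ)‖ * ‖(w₁' - w₁) + (w₂' - w₂)‖) +
        ‖B‖ * (‖(((r + r ^ 2) / 4 : ℝ) : ℂ)‖ *
        ‖(w₁' - w₁) * (w₁' + w₁) + (w₂' - w₂) * (w₂' + w₂)‖ + ‖((r ^ 2 / 2 : ℝ) : ℂ)‖ *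
        ‖(w₁' - w₁) * w₂' + w₁ * (w₂' - w₂)‖) := by
        refine (norm_sub_le _ _).trans ?_
        rw [norm_mul, norm_mul, norm_mul]
        gcongr
        refine (norm_add_le _ _).trans ?_
        rw [norm_mul, norm_mul]
    _ ≤ 1 / 1 / g * (1 / 4 * (δ₁ + δ₂)) + 1 / 2 / g * (3 / 16 * (δ₁ * 2 + δ₂ * 2) +
        1 / 8 * (δ₁ * 1 + 1 * δ₂)) := by gcongr
    _ = (δ₁ + δ₂) * (0.5 / g) := by field_simp; norm_num; ring

/-- The second-order coefficient of the logarithm of a moment of order `-2r` of the length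
distortions, including the Itô correction, is the sum of a part invariant under common rotations
of the two vectors, which is at most `-(r/2)(1 - 2r)`, and of an oscillating part. -/
lemma second_order_eq (r : ℝ) {w₁ w₂ : ℂ} (h₁ : w₁.re ^ 2 + w₁.im ^ 2 = 1)
    (h₂ : w₂.re ^ 2 + w₂.im ^ 2 = 1) :
    -r * (((1 - w₁.re) / 2 - w₁.im ^ 2 / 2) + ((1 - w₂.re) / 2 - w₂.im ^ 2 / 2)) +
      r ^ 2 * (w₁.im + w₂.im) ^ 2 / 2 =
    -(r / 2) * (1 - r * (1 + (w₁.re * w₂.re + w₁.im * w₂.im))) + (trigPoly r 1 1 w₁ w₂).re := by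
  have e : (trigPoly r 1 1 w₁ w₂).re = r / 2 * (w₁.re + w₂.re) -
      ((r + r ^ 2) / 4 * ((w₁.re ^ 2 - w₁.im ^ 2) + (w₂.re ^ 2 - w₂.im ^ 2)) +
        r ^ 2 / 2 * (w₁.re * w₂.re - w₁.im * w₂.im)) := by
    simp only [trigPoly, one_mul, Complex.sub_re, Complex.add_re, Complex.ofReal_re, Complex.ofReal_im,
      pow_two, Complex.mul_re]
    ring
  rw [e]
  linear_combination ((r + r ^ 2) / 4) * h₁ + ((r + r ^ 2) / 4) * h₂

/-! ### The Lyapunov function of a pair of vectors -/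

lemma exp_le_cubic {y : ℝ} (hy : |y| ≤ 1) : Real.exp y ≤ 1 + y + y ^ 2 / 2 + |y| ^ 3 := by
  have h := (abs_le.mp (Real.exp_bound hy (n := 3) (by norm_num))).2
  simp only [Finset.sum_range_succ, Finset.sum_range_zero] at h
  norm_num [Nat.factorial] at h
  have := pow_nonneg (abs_nonneg y) 3
  linarith

/-- Second-order expansion, with explicit remainder, of the exponential of a perturbation that is
linear in `t` up to quadratic terms. -/
lemma exp_energy_le {r d₁ d₂ a₁ a₂ t h T Q e₁ e₂ Γ₀ Γ₁ : ℝ} (hr0 : 0 ≤ r) (hr : r ≤ 1 / 2)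
    (hd₁ : |d₁| ≤ 1) (hd₂ : |d₂| ≤ 1) (ha₁ : |a₁| ≤ 1) (ha₂ : |a₂| ≤ 1)
    (ht : |t| ≤ T) (hT : T ≤ 1 / 345) (hh0 : 0 ≤ h) (hh : h ≤ T / 100)
    (hTQ : T ^ 2 ≤ Q) (hQ : Q ≤ T / 345)
    (he₁ : |e₁| ≤ 3 * |t| ^ 3) (he₂ : |e₂| ≤ 3 * |t - h| ^ 3)
    (hΓ₀ : |Γ₀| ≤ 1.5 * Q) (hΓ₁ : |Γ₁| ≤ 3 * T * Q) :
    Real.exp (-r * ((-(t * d₁) + t ^ 2 * a₁ + e₁) + (-((t - h) * d₂) + (t - h) ^ 2 * a₂ + e₂)) +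
      Γ₀ + Γ₁) ≤
    1 + t * (r * (d₁ + d₂)) + t ^ 2 * (-r * (a₁ + a₂) + r ^ 2 * (d₁ + d₂) ^ 2 / 2) + Γ₀ + h +
      16 * (T * Q) ∧
    Real.exp (-r * ((-(t * d₁) + t ^ 2 * a₁ + e₁) + (-((t - h) * d₂) + (t - h) ^ 2 * a₂ + e₂)) +
      Γ₀ + Γ₁) ≤ 1.05 := by
  have hT0 : 0 ≤ T := (abs_nonneg t).trans ht
  have hQ0 : 0 ≤ Q := (sq_nonneg T).trans hTQ
  have hT3 : T ^ 3 ≤ T * Q := by nlinarith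
  have hTh : T * h ≤ h / 345 := by nlinarith
  have hTQ1 : T * Q ≤ Q / 345 := by nlinarith
  have hh2 : h ^ 2 ≤ h / 345 / 100 := by nlinarith
  have hth : |t - h| ≤ 1.01 * T := by
    refine (abs_sub _ _).trans ?_
    rw [abs_of_nonneg hh0]
    linarith
  set B := r * t * (d₁ + d₂) with hB
  set E := -r * h * d₂ - r * (-2 * t * h + h ^ 2) * a₂ - r * (e₁ + e₂) + Γ₁ with hE
  set R := -r * t ^ 2 * (a₁ + a₂) + Γ₀ + E with hR
  have hY : -r * ((-(t * d₁) + t ^ 2 * a₁ + e₁) + (-((t - h) * d₂) + (t - h) ^ 2 * a₂ + e₂)) +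
      Γ₀ + Γ₁ = B + R := by rw [hR, hE, hB]; ring
  have hrabs : |r| ≤ 1 / 2 := by rwa [abs_of_nonneg hr0]
  have hBT : |B| ≤ T := by
    rw [hB, abs_mul, abs_mul]
    have : |d₁ + d₂| ≤ 2 := (abs_add_le _ _).trans (by linarith)
    calc |r| * |t| * |d₁ + d₂| ≤ 1 / 2 * T * 2 := by gcongr
      _ = T := by ring
  have hET : |E| ≤ 0.51 * h + 6.2 * (T * Q) := by
    have k1 : |-r * h * d₂| ≤ 1 / 2 * h * 1 := by
      rw [abs_mul, abs_mul, abs_neg, abs_of_nonneg hh0]; gcongr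
    have k2 : |r * (-2 * t * h + h ^ 2) * a₂| ≤ 1 / 2 * (2 * T * h + h ^ 2) * 1 := by
      rw [abs_mul, abs_mul]
      have : |-2 * t * h + h ^ 2| ≤ 2 * T * h + h ^ 2 := by
        refine (abs_add_le _ _).trans ?_
        rw [abs_mul, abs_mul, abs_of_nonneg hh0, abs_of_nonneg (sq_nonneg h)]
        norm_num
        gcongr
      gcongr
    have k3 : |r * (e₁ + e₂)| ≤ 1 / 2 * (3 * T ^ 3 + 3 * (1.01 * T) ^ 3) := by
      rw [abs_mul]
      have q1 : |e₁| ≤ 3 * T ^ 3 := he₁.trans (by gcongr)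
      have q2 : |e₂| ≤ 3 * (1.01 * T) ^ 3 := he₂.trans (by gcongr)
      have : |e₁ + e₂| ≤ 3 * T ^ 3 + 3 * (1.01 * T) ^ 3 := (abs_add_le _ _).trans (by linarith)
      gcongr
    have : |E| ≤ |-r * h * d₂| + |r * (-2 * t * h + h ^ 2) * a₂| + |r * (e₁ + e₂)| + |Γ₁| := by
      rw [hE]
      refine (abs_add_le _ _).trans ?_
      gcongr
      refine (abs_sub _ _).trans ?_
      gcongr
      exact abs_sub _ _
    have hcube : (1.01 * T) ^ 3 = 1.030301 * T ^ 3 := by ring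
    rw [hcube] at k3
    linarith [mul_nonneg hT0 hQ0]
  have hRT : |R| ≤ 2.53 * Q + 0.51 * h := by
    have k1 : |-r * t ^ 2 * (a₁ + a₂)| ≤ 1 / 2 * T ^ 2 * 2 := by
      rw [abs_mul, abs_mul, abs_neg, abs_pow]
      have : |a₁ + a₂| ≤ 2 := (abs_add_le _ _).trans (by linarith)
      gcongr
    have : |R| ≤ |-r * t ^ 2 * (a₁ + a₂)| + |Γ₀| + |E| := by
      rw [hR]
      refine (abs_add_le _ _).trans ?_
      gcongr
      exact abs_add_le _ _
    linarith
  have hRT' : |R| ≤ 0.0125 * T := by linarith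
  have hYT : |B + R| ≤ 1.02 * T := (abs_add_le _ _).trans (by linarith)
  have hexp := exp_le_cubic (hYT.trans (by linarith))
  rw [hY]
  have hcub : |B + R| ^ 3 ≤ 1.07 * (T * Q) := by
    calc |B + R| ^ 3 ≤ (1.02 * T) ^ 3 := by gcongr
      _ = 1.061208 * T ^ 3 := by ring
      _ ≤ 1.07 * (T * Q) := by linarith [mul_nonneg hT0 hQ0]
  have hBR : B * R ≤ T * (2.53 * Q + 0.51 * h) := by
    calc B * R ≤ |B * R| := le_abs_self _
      _ = |B| * |R| := abs_mul _ _
      _ ≤ _ := by gcongr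
  have hRR : R ^ 2 ≤ 0.0125 * T * (2.53 * Q + 0.51 * h) := by
    rw [← sq_abs, pow_two]
    gcongr
  refine ⟨?_, (Real.exp_le_exp.mpr ((le_abs_self _).trans (hYT.trans
    (by linarith : 1.02 * T ≤ 0.003)))).trans ((exp_le_cubic (by norm_num [abs_of_pos])).trans
    (by norm_num [abs_of_pos]))⟩
  have hEle := le_abs_self E
  have hTQ0 : 0 ≤ T * Q := mul_nonneg hT0 hQ0
  have hfin : 1 + (B + R) + (B + R) ^ 2 / 2 = 1 + t * (r * (d₁ + d₂)) +
      t ^ 2 * (-r * (a₁ + a₂) + r ^ 2 * (d₁ + d₂) ^ 2 / 2) + Γ₀ + E + B * R + R ^ 2 / 2 := by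
    rw [hR, hB]; ring
  rw [hfin] at hexp
  linarith

lemma sinAngle_nonneg (x y : ℂ) : 0 ≤ sinAngle x y := by unfold sinAngle; positivity

lemma sinAngle_le_one (x y : ℂ) : sinAngle x y ≤ 1 := by
  unfold sinAngle
  refine div_le_one_of_le₀ ?_ (by positivity)
  refine (Complex.abs_im_le_norm _).trans ?_
  rw [norm_mul, RCLike.norm_conj]

lemma sinAngle_mul {ζ : ℂ} (hζ : ‖ζ‖ = 1) (x y : ℂ) : sinAngle (ζ * x) (ζ * y) = sinAngle x y := by
  have hc : (starRingEnd ℂ) ζ * ζ = 1 := by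
    rw [mul_comm, Complex.mul_conj, Complex.normSq_eq_norm_sq, hζ]; simp
  have : (starRingEnd ℂ) (ζ * x) * (ζ * y) = (starRingEnd ℂ) x * y := by
    rw [map_mul]
    linear_combination ((starRingEnd ℂ) x * y) * hc
  rw [sinAngle, sinAngle, this, norm_mul, norm_mul, hζ, one_mul, one_mul]

lemma shearFactor_pos {t : ℝ} (ht : |t| ≤ 1 / 100) {w : ℂ} (hw : ‖w‖ ≤ 1) :
    0 < shearFactor t w := by
  have := (abs_le.mp (abs_shearFactor_sub_one_le ht hw)).1
  linarith

lemma norm_shear {t : ℝ} (ht : |t| ≤ 1 / 100) {u : ℂ} (hu : u ≠ 0) :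
    ‖shear t u‖ = ‖u‖ * Real.exp (Real.log (shearFactor t (phase u)) / 2) := by
  have hq := shearFactor_pos ht (norm_phase_le_one u)
  rw [← sq_eq_sq₀ (norm_nonneg _) (by positivity), norm_shear_sq t hu, mul_pow, ← Real.exp_nat_mul]
  congr 1
  push_cast
  rw [mul_div_cancel₀ _ (two_ne_zero), Real.exp_log hq]

/-- A common shear changes the sine of an angle only through the lengths; a difference `h` between
the two shears costs at most `h`. -/
lemma sinAngle_shear_le {t t' : ℝ} (ht : |t| ≤ 1 / 100) (ht' : |t'| ≤ 1 / 100) {x y : ℂ}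
    (hx : x ≠ 0) (hy : y ≠ 0) :
    sinAngle (shear t x) (shear t' y) ≤ (sinAngle x y + |t - t'|) *
      Real.exp (-(Real.log (shearFactor t (phase x)) + Real.log (shearFactor t' (phase y))) / 2) := by
  have hxp : 0 < ‖x‖ := norm_pos_iff.mpr hx
  have hyp : 0 < ‖y‖ := norm_pos_iff.mpr hy
  have hIm : ((starRingEnd ℂ) (shear t x) * shear t' y).im =
      ((starRingEnd ℂ) x * y).im + (t' - t) * (x.im * y.im) := by
    simp [Complex.mul_im]
    ring
  rw [sinAngle, hIm, norm_shear ht hx, norm_shear ht' hy, div_le_iff₀ (by positivity)]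
  have e : Real.exp (-(Real.log (shearFactor t (phase x)) +
      Real.log (shearFactor t' (phase y))) / 2) *
      (‖x‖ * Real.exp (Real.log (shearFactor t (phase x)) / 2) *
      (‖y‖ * Real.exp (Real.log (shearFactor t' (phase y)) / 2))) = ‖x‖ * ‖y‖ := by
    calc _ = ‖x‖ * ‖y‖ * (Real.exp (-(Real.log (shearFactor t (phase x)) +
      Real.log (shearFactor t' (phase y))) / 2) *
      Real.exp (Real.log (shearFactor t (phase x)) / 2) *
      Real.exp (Real.log (shearFactor t' (phase y)) / 2)) := by ring
      _ = ‖x‖ * ‖y‖ := by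
        rw [← Real.exp_add, ← Real.exp_add]
        ring_nf
        rw [Real.exp_zero, mul_one]
  rw [mul_assoc, e, sinAngle, add_mul, div_mul_cancel₀ _ (by positivity)]
  refine (abs_add_le _ _).trans ?_
  gcongr
  rw [abs_mul, abs_mul, abs_sub_comm]
  gcongr
  · exact Complex.abs_im_le_norm x
  · exact Complex.abs_im_le_norm y

lemma rpow_add_le_add_rpow_of_le_one {a b p : ℝ} (ha : 0 ≤ a) (hb : 0 ≤ b) (hp : 0 ≤ p)
    (hp1 : p ≤ 1) : (a + b) ^ p ≤ a ^ p + b ^ p := by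
  lift a to ℝ≥0 using ha
  lift b to ℝ≥0 using hb
  exact_mod_cast NNReal.rpow_add_le_add_rpow a b hp hp1

lemma abs_quadratic_coeff_le {c d : ℝ} (hc : |c| ≤ 1) (hd : |d| ≤ 1) :
    |(1 - c) / 2 - d ^ 2 / 2| ≤ 1 := by
  have h3 : d ^ 2 ≤ 1 := by rw [← sq_abs]; exact pow_le_one₀ (abs_nonneg _) hd
  have h4 := sq_nonneg d
  rw [abs_le] at *
  constructor <;> linarith

/-- The Lyapunov function of the pair dynamics: a power of the sine of the angle between the two
solution vectors, times the exponential of the corrector scaled by the variance `τ²`. -/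
noncomputable def lyapunov (r τ : ℝ) (ζ x y : ℂ) : ℝ :=
  sinAngle x y ^ (2 * r) * Real.exp (τ ^ 2 * corrector r ζ (phase x) (phase y))

lemma lyapunov_nonneg (r τ : ℝ) (ζ x y : ℂ) : 0 ≤ lyapunov r τ ζ x y := by
  have := sinAngle_nonneg x y
  unfold lyapunov; positivity

/-- Parameters of the pair dynamics: `ζ = e^{ik}` is the free rotation, `2r` the power of the sine of
the angle, `g` a lower bound for `2 |sin k|` and `|sin 2k|`, `τ` the standard deviation of the random
shears, `T` a bound on their size, and `h` the shift of the shears caused by the energy difference.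
The numerical conditions make the errors of the second-order expansion small. -/
structure StepParams (r τ g T h : ℝ) (ζ : ℂ) : Prop where
  r_pos : 0 < r
  r_le : r ≤ 1 / 2
  τ_nonneg : 0 ≤ τ
  τ_le : τ ≤ T
  g_pos : 0 < g
  g_le : g ≤ 1
  T_le : T ≤ g / 345
  h_nonneg : 0 ≤ h
  h_le : h ≤ T / 100
  norm_ζ : ‖ζ‖ = 1
  le_norm_two : g ≤ ‖1 - (starRingEnd ℂ) ζ ^ 2‖
  le_norm_four : 2 * g ≤ ‖1 - (starRingEnd ℂ) ζ ^ 4‖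

namespace StepParams
variable {r τ g T h : ℝ} {ζ : ℂ}

lemma T_nonneg (H : StepParams r τ g T h ζ) : 0 ≤ T := H.τ_nonneg.trans H.τ_le

lemma T_le' (H : StepParams r τ g T h ζ) : T ≤ 1 / 345 := by
  have := H.T_le; have := H.g_le; linarith

lemma sq_le_sq_div (H : StepParams r τ g T h ζ) : T ^ 2 ≤ T ^ 2 / g :=
  le_div_self (sq_nonneg _) H.g_pos H.g_le

lemma sq_div_le (H : StepParams r τ g T h ζ) : T ^ 2 / g ≤ T / 345 := by
  rw [div_le_iff₀ H.g_pos]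
  have := H.T_le; have := H.T_nonneg
  nlinarith

lemma abs_sq_mul_corrector_le (H : StepParams r τ g T h ζ) {w₁ w₂ : ℂ} (h₁ : ‖w₁‖ ≤ 1)
    (h₂ : ‖w₂‖ ≤ 1) : |τ ^ 2 * corrector r ζ w₁ w₂| ≤ 0.75 * (T ^ 2 / g) := by
  have h0 := abs_corrector_le H.r_pos.le H.r_le H.g_pos H.le_norm_two H.le_norm_four h₁ h₂
  rw [abs_mul, abs_of_nonneg (sq_nonneg τ)]
  calc τ ^ 2 * |corrector r ζ w₁ w₂| ≤ T ^ 2 * (0.75 / g) := by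
        have := H.τ_nonneg
        have := H.τ_le
        gcongr
    _ = 0.75 * (T ^ 2 / g) := by ring

lemma exp_corrector_le (H : StepParams r τ g T h ζ) (x y : ℂ) :
    Real.exp (τ ^ 2 * corrector r ζ (phase x) (phase y)) ≤ 1.01 := by
  have h1 := (le_abs_self _).trans
    (H.abs_sq_mul_corrector_le (norm_phase_le_one x) (norm_phase_le_one y))
  have h2 := H.sq_div_le
  have h3 := H.T_le'
  have h4 : τ ^ 2 * corrector r ζ (phase x) (phase y) ≤ 0.0001 := by linarith
  refine (Real.exp_le_exp.mpr h4).trans ?_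
  refine (exp_le_cubic (by norm_num [abs_of_pos])).trans ?_
  norm_num [abs_of_pos]

lemma le_exp_corrector (H : StepParams r τ g T h ζ) (x y : ℂ) :
    0.99 ≤ Real.exp (τ ^ 2 * corrector r ζ (phase x) (phase y)) := by
  have h1 := (neg_le_of_abs_le
    (H.abs_sq_mul_corrector_le (norm_phase_le_one x) (norm_phase_le_one y)))
  have h2 := H.sq_div_le
  have h3 := H.T_le'
  refine le_trans ?_ (Real.add_one_le_exp _)
  linarith

lemma lyapunov_le (H : StepParams r τ g T h ζ) (x y : ℂ) : lyapunov r τ ζ x y ≤ 1.01 := by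
  have h1 : sinAngle x y ^ (2 * r) ≤ 1 :=
    Real.rpow_le_one (sinAngle_nonneg x y) (sinAngle_le_one x y) (by linarith [H.r_pos])
  unfold lyapunov
  calc _ ≤ 1 * 1.01 :=
        mul_le_mul h1 (H.exp_corrector_le x y) (Real.exp_pos _).le zero_le_one
    _ = 1.01 := one_mul _

/-- Pointwise bound of the Lyapunov function after one step by a quadratic polynomial in the random
shear parameter `t`. -/
lemma lyapunov_step_le (H : StepParams r τ g T h ζ) {x y : ℂ} (hx : x ≠ 0) (hy : y ≠ 0) {t : ℝ}
    (ht : |t| ≤ T) :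
    lyapunov r τ ζ (shear t (ζ * x)) (shear (t - h) (ζ * y)) ≤
      lyapunov r τ ζ x y * (1 + t * (r * ((phase (ζ * x)).im + (phase (ζ * y)).im)) +
        t ^ 2 * (-(r / 2) * (1 - r * (1 + ((phase (ζ * x)).re * (phase (ζ * y)).re +
          (phase (ζ * x)).im * (phase (ζ * y)).im))) +
          (trigPoly r 1 1 (phase (ζ * x)) (phase (ζ * y))).re) -
        τ ^ 2 * (trigPoly r 1 1 (phase (ζ * x)) (phase (ζ * y))).re + h + 16 * (T ^ 3 / g)) +
      1.1 * h ^ (2 * r) := by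
  have hζ0 : ζ ≠ 0 := by
    intro h0; have := H.norm_ζ; rw [h0, norm_zero] at this; exact zero_ne_one this
  have hux : ζ * x ≠ 0 := mul_ne_zero hζ0 hx
  have huy : ζ * y ≠ 0 := mul_ne_zero hζ0 hy
  have hT0 := H.T_nonneg
  have hT1 := H.T_le'
  have hQ1 := H.sq_le_sq_div
  have hQ2 := H.sq_div_le
  have hh0 := H.h_nonneg
  have hh1 := H.h_le
  have hr0 := H.r_pos
  have hr1 := H.r_le
  have hg0 := H.g_pos
  have hth : |t - h| ≤ 1.01 * T := by
    refine (abs_sub _ _).trans ?_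
    rw [abs_of_nonneg hh0]
    linarith
  have ht1 : |t| ≤ 1 / 100 := by linarith
  have ht2 : |t - h| ≤ 1 / 100 := by linarith
  have hsin := sinAngle_shear_le ht1 ht2 hux huy
  rw [sinAngle_mul H.norm_ζ, show t - (t - h) = h by ring, abs_of_nonneg hh0] at hsin
  have hw1 := norm_phase_le_one (ζ * x)
  have hw2 := norm_phase_le_one (ζ * y)
  have hsq1 := phase_re_sq_add_im_sq hux
  have hsq2 := phase_re_sq_add_im_sq huy
  have hL1 := abs_log_shearFactor_sub_le ht1 hw1
  have hL2 := abs_log_shearFactor_sub_le ht2 hw2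
  have hG1 : |τ ^ 2 * (corrector r ζ (phase (shear t (ζ * x))) (phase (shear (t - h) (ζ * y))) -
      corrector r ζ (phase (ζ * x)) (phase (ζ * y)))| ≤ 3 * T * (T ^ 2 / g) := by
    have k := abs_corrector_sub_le hr0.le hr1 hg0 H.le_norm_two H.le_norm_four hw1 hw2
      (norm_phase_le_one (shear t (ζ * x))) (norm_phase_le_one (shear (t - h) (ζ * y)))
    have k1 := norm_phase_shear_sub_le ht1 hux
    have k2 := norm_phase_shear_sub_le ht2 huy
    rw [abs_mul, abs_of_nonneg (sq_nonneg τ)]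
    have hτ0 := H.τ_nonneg
    have hτ1 := H.τ_le
    calc _ ≤ T ^ 2 * ((2.1 * T + 2.1 * (1.01 * T)) * (0.5 / g)) := by
          gcongr
          refine k.trans ?_
          gcongr
          · exact k1.trans (by linarith)
          · exact k2.trans (by linarith)
      _ = 2.1105 * (T * (T ^ 2 / g)) := by ring
      _ ≤ 3 * T * (T ^ 2 / g) := by
          have : 0 ≤ T * (T ^ 2 / g) := by positivity
          linarith
  have hG0 := corrector_rotate_sub r H.norm_ζ
    (norm_pos_iff.mp (hg0.trans_le H.le_norm_two))
    (norm_pos_iff.mp ((by positivity : 0 < 2 * g).trans_le H.le_norm_four)) (phase x) (phase y)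
  rw [← phase_mul H.norm_ζ, ← phase_mul H.norm_ζ] at hG0
  have hΓ₀ : |τ ^ 2 * (corrector r ζ (phase (ζ * x)) (phase (ζ * y)) -
      corrector r ζ (phase x) (phase y))| ≤ 1.5 * (T ^ 2 / g) := by
    rw [mul_sub]
    refine (abs_sub _ _).trans ?_
    have k1 := H.abs_sq_mul_corrector_le hw1 hw2
    have k2 := H.abs_sq_mul_corrector_le (norm_phase_le_one x) (norm_phase_le_one y)
    linarith
  obtain ⟨b1, b1'⟩ := abs_re_im_le_one hw1
  obtain ⟨b2, b2'⟩ := abs_re_im_le_one hw2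
  obtain ⟨hexp, hYle⟩ := exp_energy_le hr0.le hr1 b1' b2' (abs_quadratic_coeff_le b1 b1')
    (abs_quadratic_coeff_le b2 b2') ht hT1 hh0 hh1 hQ1 hQ2
    hL1 hL2 hΓ₀ hG1
  set L₁ := Real.log (shearFactor t (phase (ζ * x)))
  set L₂ := Real.log (shearFactor (t - h) (phase (ζ * y)))
  set G' := corrector r ζ (phase (shear t (ζ * x))) (phase (shear (t - h) (ζ * y)))
  set Gu := corrector r ζ (phase (ζ * x)) (phase (ζ * y))
  set G := corrector r ζ (phase x) (phase y) with hGdef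
  set Y := -r * (L₁ + L₂) + τ ^ 2 * (Gu - G) + τ ^ 2 * (G' - Gu) with hYdef
  have hpow : sinAngle (shear t (ζ * x)) (shear (t - h) (ζ * y)) ^ (2 * r) ≤
      (sinAngle x y ^ (2 * r) + h ^ (2 * r)) * Real.exp (-r * (L₁ + L₂)) := by
    calc _ ≤ ((sinAngle x y + h) * Real.exp (-(L₁ + L₂) / 2)) ^ (2 * r) :=
          Real.rpow_le_rpow (sinAngle_nonneg _ _) hsin (by positivity)
      _ = (sinAngle x y + h) ^ (2 * r) * Real.exp (-r * (L₁ + L₂)) := by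
          rw [Real.mul_rpow (add_nonneg (sinAngle_nonneg _ _) hh0) (Real.exp_pos _).le,
            ← Real.exp_mul]
          congr 2
          ring
      _ ≤ _ := by
          gcongr
          exact rpow_add_le_add_rpow_of_le_one (sinAngle_nonneg _ _) hh0 (by positivity)
            (by linarith)
  have hmain : lyapunov r τ ζ (shear t (ζ * x)) (shear (t - h) (ζ * y)) ≤
      lyapunov r τ ζ x y * Real.exp Y + h ^ (2 * r) * (Real.exp (τ ^ 2 * G) * Real.exp Y) := by
    calc _ ≤ ((sinAngle x y ^ (2 * r) + h ^ (2 * r)) * Real.exp (-r * (L₁ + L₂))) *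
          Real.exp (τ ^ 2 * G') := by
          unfold lyapunov
          gcongr
      _ = (sinAngle x y ^ (2 * r) + h ^ (2 * r)) * (Real.exp (τ ^ 2 * G) * Real.exp Y) := by
          rw [mul_assoc, ← Real.exp_add, ← Real.exp_add, hYdef]
          congr 2
          ring
      _ = _ := by rw [lyapunov, ← hGdef]; ring
  have hidL : -r * (-(t * (phase (ζ * x)).im) +
        t ^ 2 * ((1 - (phase (ζ * x)).re) / 2 - (phase (ζ * x)).im ^ 2 / 2) +
      (L₁ - (-(t * (phase (ζ * x)).im) +
        t ^ 2 * ((1 - (phase (ζ * x)).re) / 2 - (phase (ζ * x)).im ^ 2 / 2))) +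
      (-((t - h) * (phase (ζ * y)).im) +
        (t - h) ^ 2 * ((1 - (phase (ζ * y)).re) / 2 - (phase (ζ * y)).im ^ 2 / 2) +
      (L₂ - (-((t - h) * (phase (ζ * y)).im) +
        (t - h) ^ 2 * ((1 - (phase (ζ * y)).re) / 2 - (phase (ζ * y)).im ^ 2 / 2))))) +
      τ ^ 2 * (Gu - G) + τ ^ 2 * (G' - Gu) = Y := by rw [hYdef]; ring
  rw [hidL] at hexp hYle
  rw [second_order_eq r hsq1 hsq2, hG0, show T * (T ^ 2 / g) = T ^ 3 / g by ring] at hexp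
  have hexpG := H.exp_corrector_le x y
  have hlast : h ^ (2 * r) * (Real.exp (τ ^ 2 * G) * Real.exp Y) ≤ 1.1 * h ^ (2 * r) := by
    have : Real.exp (τ ^ 2 * G) * Real.exp Y ≤ 1.01 * 1.05 := by gcongr
    have h0 : 0 ≤ h ^ (2 * r) := by positivity
    nlinarith
  refine hmain.trans (add_le_add ?_ hlast)
  refine mul_le_mul_of_nonneg_left (hexp.trans (le_of_eq ?_)) (lyapunov_nonneg _ _ _ _ _)
  ring
end StepParams

/-! ### Averaging over the potential -/

lemma measurable_phase : Measurable phase := by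
  unfold phase
  exact measurable_id.div (Complex.continuous_conj.measurable)

section Measurability
variable {α : Type*} [MeasurableSpace α] {x y : α → ℂ}

lemma Measurable.shear {t : α → ℝ} (ht : Measurable t) (hx : Measurable x) :
    Measurable fun a => shear (t a) (x a) := by
  unfold _root_.shear
  exact hx.sub (Complex.measurable_ofReal.comp (ht.mul (Complex.measurable_im.comp hx)))

lemma Measurable.sinAngle (hx : Measurable x) (hy : Measurable y) :
    Measurable fun a => sinAngle (x a) (y a) := by
  unfold _root_.sinAngle
  have h1 : Measurable fun a => (starRingEnd ℂ) (x a) := Complex.continuous_conj.measurable.comp hx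
  have h2 : Measurable fun a => ((starRingEnd ℂ) (x a) * y a).im :=
    Complex.measurable_im.comp (h1.mul hy)
  exact (continuous_abs.measurable.comp h2).div (hx.norm.mul hy.norm)

lemma Measurable.corrector (r : ℝ) (ζ : ℂ) (hx : Measurable x) (hy : Measurable y) :
    Measurable fun a => corrector r ζ (x a) (y a) := by
  unfold _root_.corrector trigPoly
  exact Complex.measurable_re.comp (by fun_prop)

lemma Measurable.lyapunov (r τ : ℝ) (ζ : ℂ) (hx : Measurable x) (hy : Measurable y) :
    Measurable fun a => lyapunov r τ ζ (x a) (y a) := by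
  unfold _root_.lyapunov
  exact ((hx.sinAngle hy).pow_const _).mul (Real.measurable_exp.comp
    ((Measurable.corrector r ζ (measurable_phase.comp hx) (measurable_phase.comp hy)).const_mul _))

end Measurability

lemma integrable_id_of_bdd {P : Measure ℝ} [IsProbabilityMeasure P] {c₀ : ℝ}
    (hP : ∀ᵐ x ∂P, |x| ≤ c₀) : Integrable (fun x : ℝ => x) P :=
  Integrable.of_bound (by fun_prop) c₀ (by simpa using hP)

lemma integrable_sq_of_bdd {P : Measure ℝ} [IsProbabilityMeasure P] {c₀ : ℝ}
    (hP : ∀ᵐ x ∂P, |x| ≤ c₀) : Integrable (fun x : ℝ => x ^ 2) P := by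
  refine Integrable.of_bound (by fun_prop) (c₀ ^ 2) ?_
  filter_upwards [hP] with x hx
  rw [norm_pow]
  exact pow_le_pow_left₀ (abs_nonneg _) hx 2

lemma integral_sq_eq_one {P : Measure ℝ} [IsProbabilityMeasure P]
    (hmean : ∫ x, x ∂P = 0) (hvar : variance (fun x : ℝ => x) P = 1) :
    ∫ x, x ^ 2 ∂P = 1 := by
  rw [← hvar, variance_of_integral_eq_zero (by fun_prop) hmean]

/-- A centred distribution with unit variance is not supported in `(-1, 1)`. -/
lemma one_le_of_variance_eq_one {P : Measure ℝ} [IsProbabilityMeasure P] {c₀ : ℝ}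
    (hmean : ∫ x, x ∂P = 0) (hvar : variance (fun x : ℝ => x) P = 1)
    (hP : ∀ᵐ x ∂P, |x| ≤ c₀) : 1 ≤ c₀ := by
  obtain ⟨x, hx⟩ := hP.exists
  have hc : 0 ≤ c₀ := (abs_nonneg x).trans hx
  have h1 : ∫ x, x ^ 2 ∂P ≤ ∫ _, c₀ ^ 2 ∂P := by
    refine integral_mono_ae (integrable_sq_of_bdd hP) (integrable_const _) ?_
    filter_upwards [hP] with x hx
    rw [← sq_abs]
    exact pow_le_pow_left₀ (abs_nonneg _) hx 2
  rw [integral_sq_eq_one hmean hvar] at h1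
  simpa [abs_of_nonneg hc] using h1

lemma integrable_lyapunov_step {r τ g T h : ℝ} {ζ : ℂ} (H : StepParams r τ g T h ζ)
    (P : Measure ℝ) [IsProbabilityMeasure P] (x y : ℂ) :
    Integrable (fun v => lyapunov r τ ζ (shear (τ * v) (ζ * x)) (shear (τ * v - h) (ζ * y))) P := by
  refine Integrable.of_bound (Measurable.aestronglyMeasurable ?_) 1.01 (ae_of_all _ fun v => ?_)
  · exact Measurable.lyapunov r τ ζ (Measurable.shear (by fun_prop) (by fun_prop))
      (Measurable.shear (by fun_prop) (by fun_prop))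
  · rw [Real.norm_eq_abs, abs_of_nonneg (lyapunov_nonneg _ _ _ _ _)]
    exact H.lyapunov_le _ _

/-- The Lyapunov function contracts on average, up to an additive term coming from the energy
difference. -/
lemma integral_lyapunov_step_le {r τ g c₀ h : ℝ} {ζ : ℂ} (H : StepParams r τ g (τ * c₀) h ζ)
    {P : Measure ℝ} [IsProbabilityMeasure P]
    (hmean : ∫ x, x ∂P = 0) (hvar : variance (fun x : ℝ => x) P = 1)
    (hP : ∀ᵐ x ∂P, |x| ≤ c₀) {x y : ℂ} (hx : x ≠ 0) (hy : y ≠ 0) :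
    ∫ v, lyapunov r τ ζ (shear (τ * v) (ζ * x)) (shear (τ * v - h) (ζ * y)) ∂P ≤
      lyapunov r τ ζ x y * (1 - τ ^ 2 * (r / 2 * (1 - 2 * r)) + h + 16 * ((τ * c₀) ^ 3 / g)) +
        1.1 * h ^ (2 * r) := by
  have hζ0 : ζ ≠ 0 := by
    intro h0; have := H.norm_ζ; rw [h0, norm_zero] at this; exact zero_ne_one this
  set w₁ := phase (ζ * x) with hw₁
  set w₂ := phase (ζ * y) with hw₂
  set f := lyapunov r τ ζ x y with hf
  have hf0 : 0 ≤ f := lyapunov_nonneg _ _ _ _ _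
  set B := r * (w₁.im + w₂.im) with hB
  set ρ := w₁.re * w₂.re + w₁.im * w₂.im with hρ
  set O := (trigPoly r 1 1 w₁ w₂).re with hO
  set C := -(r / 2) * (1 - r * (1 + ρ)) + O with hC
  have hρ1 : ρ ≤ 1 := by
    have e1 := phase_re_sq_add_im_sq (mul_ne_zero hζ0 hx)
    have e2 := phase_re_sq_add_im_sq (mul_ne_zero hζ0 hy)
    rw [← hw₁] at e1
    rw [← hw₂] at e2
    rw [hρ]
    nlinarith [sq_nonneg (w₁.re - w₂.re), sq_nonneg (w₁.im - w₂.im)]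
  have hint1 := integrable_id_of_bdd hP
  have hint2 := integrable_sq_of_bdd hP
  have hmono : ∫ v, lyapunov r τ ζ (shear (τ * v) (ζ * x)) (shear (τ * v - h) (ζ * y)) ∂P ≤
      ∫ v, ((f * τ * B) * v + (f * τ ^ 2 * C) * v ^ 2 +
        (f * (1 - τ ^ 2 * O + h + 16 * ((τ * c₀) ^ 3 / g)) + 1.1 * h ^ (2 * r))) ∂P := by
    refine integral_mono_ae ?_ ?_ ?_
    · exact integrable_lyapunov_step H P x y
    · exact ((hint1.const_mul _).add (hint2.const_mul _)).add (integrable_const _)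
    · filter_upwards [hP] with v hv
      have ht : |τ * v| ≤ τ * c₀ := by
        rw [abs_mul, abs_of_nonneg H.τ_nonneg]
        exact mul_le_mul_of_nonneg_left hv H.τ_nonneg
      refine (H.lyapunov_step_le hx hy ht).trans (le_of_eq ?_)
      rw [← hw₁, ← hw₂, ← hf, ← hB, ← hρ, ← hO, ← hC]
      ring
  refine hmono.trans ?_
  rw [integral_add (by exact (hint1.const_mul _).add (hint2.const_mul _)) (integrable_const _),
    integral_add (by exact hint1.const_mul _) (by exact hint2.const_mul _), integral_const_mul,
    integral_const_mul, hmean, integral_sq_eq_one hmean hvar, integral_const]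
  simp only [probReal_univ, one_smul, mul_zero, zero_add, mul_one]
  have hkey : -(r / 2) * (1 - r * (1 + ρ)) ≤ -(r / 2 * (1 - 2 * r)) := by
    have := H.r_pos
    nlinarith [mul_nonneg this.le this.le]
  have : f * (τ ^ 2 * (-(r / 2) * (1 - r * (1 + ρ)))) ≤ f * (τ ^ 2 * (-(r / 2 * (1 - 2 * r)))) := by
    gcongr
  rw [hC]
  linarith

/-! ### The transfer recursion in conformal coordinates -/

/-- The solution of `ψ(j+2) + ψ(j) + σ V(j) ψ(j+1) = E ψ(j+1)` with `ψ(0) = 0` and `ψ(1) = 1`. -/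
def sol (σ E : ℝ) (V : ℕ → ℝ) : ℕ → ℝ
  | 0 => 0
  | 1 => 1
  | (j + 2) => (E - σ * V j) * sol σ E V (j + 1) - sol σ E V j

@[simp] lemma sol_zero (σ E : ℝ) (V : ℕ → ℝ) : sol σ E V 0 = 0 := rfl

@[simp] lemma sol_one (σ E : ℝ) (V : ℕ → ℝ) : sol σ E V 1 = 1 := rfl

lemma sol_add_two (σ E : ℝ) (V : ℕ → ℝ) (j : ℕ) :
    sol σ E V (j + 2) = (E - σ * V j) * sol σ E V (j + 1) - sol σ E V j := rfl

/-- The pair `(ψ(j+1), ψ(j))` in the conformal coordinate in which the free transfer matrix at energy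
`2 Re ζ` is the rotation by `ζ`. -/
noncomputable def solVec (ζ : ℂ) (σ E : ℝ) (V : ℕ → ℝ) (j : ℕ) : ℂ :=
  (sol σ E V (j + 1) : ℂ) - (starRingEnd ℂ) ζ * (sol σ E V j : ℂ)

lemma solVec_re (ζ : ℂ) (σ E : ℝ) (V : ℕ → ℝ) (j : ℕ) :
    (solVec ζ σ E V j).re = sol σ E V (j + 1) - ζ.re * sol σ E V j := by
  simp [solVec]

lemma solVec_im (ζ : ℂ) (σ E : ℝ) (V : ℕ → ℝ) (j : ℕ) :
    (solVec ζ σ E V j).im = ζ.im * sol σ E V j := by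
  simp [solVec]

/-- One step of the recursion at an energy shifted by `d` is a rotation followed by a shear. -/
lemma solVec_succ {ζ : ℂ} (hζ : ζ.re ^ 2 + ζ.im ^ 2 = 1) (hS : ζ.im ≠ 0) (σ d : ℝ) (V : ℕ → ℝ)
    (j : ℕ) : solVec ζ σ (2 * ζ.re + d) V (j + 1) =
      shear (σ / ζ.im * V j - d / ζ.im) (ζ * solVec ζ σ (2 * ζ.re + d) V j) := by
  apply Complex.ext
  · rw [solVec_re, shear_re, Complex.mul_re, Complex.mul_im, solVec_re, solVec_im, sol_add_two]
    field_simp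
    linear_combination (sol σ (2 * ζ.re + d) V j) * hζ
  · rw [solVec_im, shear_im, Complex.mul_im, solVec_re, solVec_im]
    ring

lemma solVec_ne_zero {ζ : ℂ} (hζ : ζ.re ^ 2 + ζ.im ^ 2 = 1) (hS : ζ.im ≠ 0) (σ d : ℝ) (V : ℕ → ℝ)
    (j : ℕ) : solVec ζ σ (2 * ζ.re + d) V j ≠ 0 := by
  induction j with
  | zero => simp [solVec]
  | succ j ih =>
    rw [solVec_succ hζ hS]
    refine shear_ne_zero _ (mul_ne_zero ?_ ih)
    rintro rfl
    simp at hS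

lemma measurable_sol_iSup {Ω : Type*} (σ E : ℝ) (W : ℕ → Ω → ℝ) (j : ℕ) :
    Measurable[⨆ i ∈ Set.Iio j, MeasurableSpace.comap (W i) inferInstance]
        (fun ω => sol σ E (fun i => W i ω) j) ∧
      Measurable[⨆ i ∈ Set.Iio j, MeasurableSpace.comap (W i) inferInstance]
        (fun ω => sol σ E (fun i => W i ω) (j + 1)) := by
  induction j with
  | zero =>
    simp only [sol_zero, zero_add, sol_one]
    exact ⟨measurable_const, measurable_const⟩
  | succ j ih =>
    have hle : (⨆ i ∈ Set.Iio j, MeasurableSpace.comap (W i) inferInstance) ≤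
        ⨆ i ∈ Set.Iio (j + 1), MeasurableSpace.comap (W i) inferInstance :=
      biSup_mono fun i hi => Set.mem_Iio.mpr ((Set.mem_Iio.mp hi).trans j.lt_succ_self)
    have hW : Measurable[⨆ i ∈ Set.Iio (j + 1), MeasurableSpace.comap (W i) inferInstance] (W j) :=
      (comap_measurable (W j)).mono
        (le_biSup (fun i => MeasurableSpace.comap (W i) inferInstance)
          (Set.mem_Iio.mpr j.lt_succ_self)) le_rfl
    have h0 := ih.1.mono hle le_rfl
    have h1 := ih.2.mono hle le_rfl
    refine ⟨h1, ?_⟩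
    simp only [sol_add_two]
    exact ((hW.const_mul σ).const_sub E |>.mul h1).sub h0

section Independence
variable {Ω : Type*} [MeasurableSpace Ω] {Pr : Measure Ω} {W : ℕ → Ω → ℝ}

lemma measurable_sol (hW : ∀ i, Measurable (W i)) (σ E : ℝ) (j : ℕ) :
    Measurable fun ω => sol σ E (fun i => W i ω) j :=
  (measurable_sol_iSup σ E W j).1.mono (iSup₂_le fun i _ => (hW i).comap_le) le_rfl

lemma measurable_solVec (hW : ∀ i, Measurable (W i)) (ζ : ℂ) (σ E : ℝ) (j : ℕ) :
    Measurable fun ω => solVec ζ σ E (fun i => W i ω) j := by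
  unfold solVec
  exact (Complex.measurable_ofReal.comp (measurable_sol hW σ E (j + 1))).sub
    ((Complex.measurable_ofReal.comp (measurable_sol hW σ E j)).const_mul _)

/-- The pair of solution vectors at site `j` is independent of the potential met at the next step. -/
lemma indepFun_solVec_pair (hW : ∀ i, Measurable (W i)) (hind : iIndepFun W Pr)
    (ζ : ℂ) (σ E E' : ℝ) (j : ℕ) :
    IndepFun (fun ω => (solVec ζ σ E (fun i => W i ω) j, solVec ζ σ E' (fun i => W i ω) j)) (W j)
      Pr := by
  rw [IndepFun_iff_Indep]
  have hdisj : Disjoint (Set.Iio j) {j} := by simp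
  have h := indep_iSup_of_disjoint (fun i => (hW i).comap_le) hind hdisj
  have hr : (⨆ i ∈ ({j} : Set ℕ), MeasurableSpace.comap (W i) inferInstance) =
      MeasurableSpace.comap (W j) inferInstance := by simp
  rw [hr] at h
  refine indep_of_indep_of_le_left h ?_
  have hv : ∀ e : ℝ, Measurable[⨆ i ∈ Set.Iio j, MeasurableSpace.comap (W i) inferInstance]
      (fun ω => solVec ζ σ e (fun i => W i ω) j) := by
    intro e
    unfold solVec
    exact (Complex.measurable_ofReal.comp (measurable_sol_iSup σ e W j).2).sub
      ((Complex.measurable_ofReal.comp (measurable_sol_iSup σ e W j).1).const_mul _)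
  exact ((hv E).prodMk (hv E')).comap_le

/-- Expected value of the Lyapunov function along the pair of solutions at two nearby energies. -/
lemma integral_lyapunov_solVec_le [IsProbabilityMeasure Pr] (hW : ∀ i, Measurable (W i))
    (hind : iIndepFun W Pr) {P : Measure ℝ} [IsProbabilityMeasure P] (hlaw : ∀ i, Pr.map (W i) = P)
    {r g c₀ σ d ε : ℝ} {ζ : ℂ} (hS : 0 < ζ.im)
    (H : StepParams r (σ / ζ.im) g (σ / ζ.im * c₀) (d / ζ.im) ζ)
    (hmean : ∫ x, x ∂P = 0) (hvar : variance (fun x : ℝ => x) P = 1)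
    (hP : ∀ᵐ x ∂P, |x| ≤ c₀) (hε : 0 < ε)
    (hgain : ε + 16 * ((σ / ζ.im * c₀) ^ 3 / g) ≤ (σ / ζ.im) ^ 2 * (r / 2 * (1 - 2 * r)))
    (hε1 : ε ≤ 1) (j : ℕ) :
    ∫ ω, lyapunov r (σ / ζ.im) ζ (solVec ζ σ (2 * ζ.re) (fun i => W i ω) j)
      (solVec ζ σ (2 * ζ.re + d) (fun i => W i ω) j) ∂Pr ≤
      (1.01 * (d / ζ.im) + 1.1 * (d / ζ.im) ^ (2 * r)) / ε := by
  have hζ : ζ.re ^ 2 + ζ.im ^ 2 = 1 := by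
    have := H.norm_ζ
    rw [← sq_eq_sq₀ (norm_nonneg _) zero_le_one, ← Complex.normSq_eq_norm_sq,
      Complex.normSq_apply] at this
    linarith
  set τ := σ / ζ.im with hτ
  set h := d / ζ.im with hh
  set K := 1.01 * h + 1.1 * h ^ (2 * r) with hK
  have hh0 := H.h_nonneg
  have hK0 : 0 ≤ K := by positivity
  induction j with
  | zero =>
    have : ∀ ω, lyapunov r τ ζ (solVec ζ σ (2 * ζ.re) (fun i => W i ω) 0)
        (solVec ζ σ (2 * ζ.re + d) (fun i => W i ω) 0) = 0 := by
      intro ω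
      have h0 : sinAngle (1 : ℂ) 1 = 0 := by simp [sinAngle]
      have hr := H.r_pos.ne'
      simp [lyapunov, solVec, h0, Real.zero_rpow (mul_ne_zero two_ne_zero hr)]
    simp only [this, integral_zero]
    positivity
  | succ j ih =>
    set Z : Ω → ℂ × ℂ := fun ω => (solVec ζ σ (2 * ζ.re) (fun i => W i ω) j,
      solVec ζ σ (2 * ζ.re + d) (fun i => W i ω) j) with hZ
    have hZm : Measurable Z := (measurable_solVec hW ζ σ _ j).prodMk (measurable_solVec hW ζ σ _ j)
    set φ : (ℂ × ℂ) × ℝ → ℝ := fun p =>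
      lyapunov r τ ζ (shear (τ * p.2) (ζ * p.1.1)) (shear (τ * p.2 - h) (ζ * p.1.2)) with hφ
    have hφm : Measurable φ := Measurable.lyapunov r τ ζ
      (Measurable.shear (by fun_prop) (by fun_prop)) (Measurable.shear (by fun_prop) (by fun_prop))
    have hstep : ∀ ω, lyapunov r τ ζ (solVec ζ σ (2 * ζ.re) (fun i => W i ω) (j + 1))
        (solVec ζ σ (2 * ζ.re + d) (fun i => W i ω) (j + 1)) = φ (Z ω, W j ω) := by
      intro ω
      have e0 := solVec_succ hζ hS.ne' σ 0 (fun i => W i ω) j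
      rw [add_zero, zero_div, sub_zero] at e0
      rw [e0, solVec_succ hζ hS.ne' σ d (fun i => W i ω) j]
    have hmap := (indepFun_iff_map_prod_eq_prod_map_map hZm.aemeasurable (hW j).aemeasurable).mp
      (indepFun_solVec_pair hW hind ζ σ (2 * ζ.re) (2 * ζ.re + d) j)
    rw [hlaw j] at hmap
    have : IsProbabilityMeasure (Pr.map Z) := Measure.isProbabilityMeasure_map hZm.aemeasurable
    have hφi : Integrable φ ((Pr.map Z).prod P) := by
      refine Integrable.of_bound hφm.aestronglyMeasurable 1.01 (ae_of_all _ fun p => ?_)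
      rw [Real.norm_eq_abs, abs_of_nonneg (lyapunov_nonneg _ _ _ _ _)]
      exact H.lyapunov_le _ _
    have hli : Integrable (fun ω => lyapunov r τ ζ (Z ω).1 (Z ω).2) Pr := by
      refine Integrable.of_bound (Measurable.lyapunov r τ ζ hZm.fst hZm.snd).aestronglyMeasurable
        1.01 (ae_of_all _ fun p => ?_)
      rw [Real.norm_eq_abs, abs_of_nonneg (lyapunov_nonneg _ _ _ _ _)]
      exact H.lyapunov_le _ _
    calc _ = ∫ ω, φ (Z ω, W j ω) ∂Pr := by simp_rw [hstep]
      _ = ∫ p, φ p ∂((Pr.map Z).prod P) := by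
          rw [← hmap, integral_map (hZm.prodMk (hW j)).aemeasurable hφm.aestronglyMeasurable]
      _ = ∫ z, ∫ v, φ (z, v) ∂P ∂(Pr.map Z) := integral_prod _ hφi
      _ = ∫ ω, ∫ v, φ (Z ω, v) ∂P ∂Pr := by
          rw [integral_map hZm.aemeasurable]
          exact hφi.integral_prod_left.aestronglyMeasurable
      -- The terms `h * lyapunov` and `h ^ (2 * r)` are absorbed into `K`.
      _ ≤ ∫ ω, ((1 - ε) * lyapunov r τ ζ (Z ω).1 (Z ω).2 + K) ∂Pr := by
          refine integral_mono ?_ ((hli.const_mul _).add (integrable_const _)) fun ω => ?_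
          · exact hφi.integral_prod_left.comp_measurable hZm
          · have hx : (Z ω).1 ≠ 0 := by
              have := solVec_ne_zero hζ hS.ne' σ 0 (fun i => W i ω) j
              rwa [add_zero] at this
            have hy : (Z ω).2 ≠ 0 := solVec_ne_zero hζ hS.ne' σ d (fun i => W i ω) j
            have k := integral_lyapunov_step_le H hmean hvar hP hx hy
            have k0 := lyapunov_nonneg r τ ζ (Z ω).1 (Z ω).2
            have k1 := H.lyapunov_le (Z ω).1 (Z ω).2
            simp only [hφ]
            refine k.trans ?_
            rw [hK]
            nlinarith
      _ = (1 - ε) * ∫ ω, lyapunov r τ ζ (Z ω).1 (Z ω).2 ∂Pr + K := by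
          rw [integral_add (hli.const_mul _) (integrable_const _), integral_const_mul]
          simp
      _ ≤ (1 - ε) * (K / ε) + K := by
          have : 0 ≤ 1 - ε := by linarith
          gcongr
      _ = K / ε := by field_simp; ring
end Independence

/-! ### Relative oscillation -/

/-- Bookkeeping of signs in one step of relative oscillation: `s`, `u`, `i` are the signs of the product
of the two solutions, of their Wronskian and of the inner product of the solution vectors, and
`s'`, `u'`, `i'` those at the next site. The count `e` is a telescoping term unless the inner product
changes sign, in which case `m ≥ 1` compensates. -/
lemma signed_step {e s s' u u' i i' : ℝ} {m : ℝ} (hm : 0 ≤ m)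
    (hs : s = 1 ∨ s = -1) (hs' : s' = 1 ∨ s' = -1) (hu : u = 1 ∨ u = -1) (hu' : u' = 1 ∨ u' = -1)
    (hi : i = 1 ∨ i = -1) (hi' : i' = 1 ∨ i' = -1)
    (h1 : e = (s - s') * u' / 2) (h2 : u ≠ u' → s = u' ∧ i' = u') (h3 : m < 1 → i = i') :
    e ≤ m + (-(u' * s') / 2 - -(u * s) / 2) - ((1 - u' * i') / 2 - (1 - u * i) / 2) := by
  rcases lt_or_ge m 1 with hm1 | hm1
  · obtain rfl := h3 hm1
    by_cases huu : u = u'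
    · subst huu
      rcases hs with rfl | rfl <;> rcases hs' with rfl | rfl <;> rcases hu with rfl | rfl <;>
      rcases hi with rfl | rfl <;> linarith
    · obtain ⟨rfl, rfl⟩ := h2 huu
      rcases hs with rfl | rfl <;> rcases hs' with rfl | rfl <;> rcases hu with rfl | rfl <;>
      first | exact absurd rfl huu | linarith
  · by_cases huu : u = u'
    · subst huu
      rcases hs with rfl | rfl <;> rcases hs' with rfl | rfl <;> rcases hu with rfl | rfl <;>
      rcases hi with rfl | rfl <;> rcases hi' with rfl | rfl <;> linarith
    · obtain ⟨rfl, rfl⟩ := h2 huu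
      rcases hs with rfl | rfl <;> rcases hs' with rfl | rfl <;> rcases hu with rfl | rfl <;>
      rcases hi with rfl | rfl <;> first | exact absurd rfl huu | linarith

/-- The sign of a real number, with the value `1` at `0`. -/
noncomputable def sg (x : ℝ) : ℝ := if 0 ≤ x then 1 else -1

lemma sg_eq (x : ℝ) : sg x = 1 ∨ sg x = -1 := by
  unfold sg; split_ifs <;> simp

lemma sg_of_nonneg {x : ℝ} (h : 0 ≤ x) : sg x = 1 := if_pos h

lemma sg_of_neg {x : ℝ} (h : x < 0) : sg x = -1 := if_neg h.not_ge

lemma sg_mul {x y : ℝ} (hx : x ≠ 0) (hy : y ≠ 0) : sg (x * y) = sg x * sg y := by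
  rcases hx.lt_or_gt with h | h <;> rcases hy.lt_or_gt with k | k
  · rw [sg_of_neg h, sg_of_neg k, sg_of_nonneg (mul_pos_of_neg_of_neg h k).le]; norm_num
  · rw [sg_of_neg h, sg_of_nonneg k.le, sg_of_neg (mul_neg_of_neg_of_pos h k)]; norm_num
  · rw [sg_of_nonneg h.le, sg_of_neg k, sg_of_neg (mul_neg_of_pos_of_neg h k)]; norm_num
  · rw [sg_of_nonneg h.le, sg_of_nonneg k.le, sg_of_nonneg (mul_pos h k).le]; norm_num

lemma ite_pos_eq_sg {x : ℝ} (hx : x ≠ 0) : (if 0 < x then 1 else 0 : ℝ) = (1 + sg x) / 2 := by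
  rcases hx.lt_or_gt with h | h
  · rw [if_neg h.le.not_gt, sg_of_neg h]; norm_num
  · rw [if_pos h, sg_of_nonneg h.le]; norm_num

/-- Difference of the sign-agreement counts of two consecutive pairs, in terms of the sign of their
Wronskian. -/
lemma ite_sub_ite_eq {p p' q q' : ℝ} (hp : p ≠ 0) (hp' : p' ≠ 0) (hq : q ≠ 0) (hq' : q' ≠ 0) :
    (if 0 < q' * q then 1 else 0 : ℝ) - (if 0 < p' * p then 1 else 0) =
      (sg (p * q) - sg (p' * q')) * sg (p * q' - p' * q) / 2 := by
  rw [ite_pos_eq_sg (mul_ne_zero hq' hq), ite_pos_eq_sg (mul_ne_zero hp' hp), sg_mul hq' hq,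
    sg_mul hp' hp, sg_mul hp hq, sg_mul hp' hq']
  rcases hp.lt_or_gt with h1 | h1 <;> rcases hp'.lt_or_gt with h2 | h2 <;>
  rcases hq.lt_or_gt with h3 | h3 <;> rcases hq'.lt_or_gt with h4 | h4 <;>
  simp only [sg_of_neg, sg_of_nonneg, h1, h2, h3, h4, h1.le, h2.le, h3.le, h4.le] <;>
  first
  | ring1
  | (rw [sg_of_nonneg (by nlinarith)]; ring1)
  | (rw [sg_of_neg (by nlinarith)]; ring1)

lemma re_conj_mul_solVec (ζ : ℂ) (σ E E' : ℝ) (V : ℕ → ℝ) (j : ℕ) :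
    ((starRingEnd ℂ) (solVec ζ σ E V j) * solVec ζ σ E' V j).re =
      (sol σ E V (j + 1) - ζ.re * sol σ E V j) * (sol σ E' V (j + 1) - ζ.re * sol σ E' V j) +
        ζ.im ^ 2 * (sol σ E V j * sol σ E' V j) := by
  rw [Complex.mul_re, Complex.conj_re, Complex.conj_im, solVec_re, solVec_re, solVec_im, solVec_im]
  ring

/-- Where the Wronskian changes sign, the inner product of the two solution vectors has the sign of
the product of the two solutions. -/
lemma inner_mul_pos_of_wronskian_small {ξ η p q S d : ℝ} (hp : p ≠ 0) (hq : q ≠ 0) (hS : d < 2 * S)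
    (hd : 0 ≤ d) (hw : |p * η - q * ξ| ≤ d * |p * q|) :
    0 < (ξ * η + S ^ 2 * (p * q)) * (p * q) := by
  have hpq : 0 < (p * q) ^ 2 := by positivity
  have hsq : (p * η - q * ξ) ^ 2 ≤ d ^ 2 * (p * q) ^ 2 := by
    rw [← sq_abs, ← sq_abs (p * q), ← mul_pow]
    exact pow_le_pow_left₀ (abs_nonneg _) hw 2
  have hdS : d ^ 2 < 4 * S ^ 2 := by nlinarith
  nlinarith [sq_nonneg (p * η + q * ξ)]

lemma wronskian_succ (σ E d : ℝ) (V : ℕ → ℝ) (j : ℕ) :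
    sol σ E V (j + 1) * sol σ (E + d) V (j + 2) - sol σ E V (j + 2) * sol σ (E + d) V (j + 1) =
      (sol σ E V j * sol σ (E + d) V (j + 1) - sol σ E V (j + 1) * sol σ (E + d) V j) +
        d * (sol σ E V (j + 1) * sol σ (E + d) V (j + 1)) := by
  rw [sol_add_two, sol_add_two]; ring

lemma sg_eq_of_mul_pos {x y : ℝ} (h : 0 < x * y) : sg x = sg y := by
  rcases pos_and_pos_or_neg_and_neg_of_mul_pos h with ⟨h1, h2⟩ | ⟨h1, h2⟩
  · rw [sg_of_nonneg h1.le, sg_of_nonneg h2.le]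
  · rw [sg_of_neg h1, sg_of_neg h2]

/-- Relative oscillation: the difference of the sign-agreement counts of the solutions at two energies
is bounded by the number of sites at which the inner product of the solution vectors changes sign.
The weights `m j` are at least `1` at those sites. -/
lemma sum_ite_sub_ite_le {ζ : ℂ} {σ d : ℝ} (hd0 : 0 < d) (hd : d < 2 * ζ.im)
    {V : ℕ → ℝ} (hp : ∀ j, sol σ (2 * ζ.re) V (j + 1) ≠ 0)
    (hq : ∀ j, sol σ (2 * ζ.re + d) V (j + 1) ≠ 0) {m : ℕ → ℝ} (hm0 : ∀ j, 0 ≤ m j)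
    (hm : ∀ j, m j < 1 →
      0 < ((starRingEnd ℂ) (solVec ζ σ (2 * ζ.re) V j) * solVec ζ σ (2 * ζ.re + d) V j).re *
        ((starRingEnd ℂ) (solVec ζ σ (2 * ζ.re) V (j + 1)) *
          solVec ζ σ (2 * ζ.re + d) V (j + 1)).re) (n : ℕ) :
    ∑ j ∈ Finset.range n,
      ((if 0 < sol σ (2 * ζ.re + d) V (j + 2) * sol σ (2 * ζ.re + d) V (j + 1) then 1 else 0 : ℝ) -
        (if 0 < sol σ (2 * ζ.re) V (j + 2) * sol σ (2 * ζ.re) V (j + 1) then 1 else 0)) ≤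
      2 + ∑ j ∈ Finset.range n, m j := by
  set p := sol σ (2 * ζ.re) V with hpdef
  set q := sol σ (2 * ζ.re + d) V with hqdef
  set w : ℕ → ℝ := fun j => p j * q (j + 1) - p (j + 1) * q j with hw
  set I : ℕ → ℝ := fun j =>
    ((starRingEnd ℂ) (solVec ζ σ (2 * ζ.re) V j) * solVec ζ σ (2 * ζ.re + d) V j).re with hI
  set Ψ : ℕ → ℝ := fun j => -(sg (w j) * sg (p (j + 1) * q (j + 1))) / 2 -
    (1 - sg (w j) * sg (I j)) / 2 with hΨ
  have hws : ∀ j, w (j + 1) = w j + d * (p (j + 1) * q (j + 1)) :=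
    fun j => wronskian_succ σ (2 * ζ.re) d V j
  have hstep : ∀ j, (if 0 < q (j + 2) * q (j + 1) then 1 else 0 : ℝ) -
      (if 0 < p (j + 2) * p (j + 1) then 1 else 0) ≤ m j + (Ψ (j + 1) - Ψ j) := by
    intro j
    have hpq : p (j + 1) * q (j + 1) ≠ 0 := mul_ne_zero (hp j) (hq j)
    have key := signed_step (m := m j) (hm0 j) (sg_eq (p (j + 1) * q (j + 1)))
      (sg_eq (p (j + 2) * q (j + 2))) (sg_eq (w j)) (sg_eq (w (j + 1))) (sg_eq (I j))
      (sg_eq (I (j + 1))) (ite_sub_ite_eq (hp j) (hp (j + 1)) (hq j) (hq (j + 1))) ?_ ?_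
    · simp only [hΨ]
      linarith
    · intro hne
      have hboth : sg (p (j + 1) * q (j + 1)) = sg (w (j + 1)) ∧
          |w (j + 1)| ≤ d * |p (j + 1) * q (j + 1)| := by
        have h := hws j
        rcases lt_or_ge (w j) 0 with h1 | h1 <;> rcases lt_or_ge (w (j + 1)) 0 with h2 | h2
        · rw [sg_of_neg h1, sg_of_neg h2] at hne; exact absurd rfl hne
        · have h3 : 0 < p (j + 1) * q (j + 1) := by
            by_contra hcon
            nlinarith
          rw [sg_of_nonneg h2, sg_of_nonneg h3.le, abs_of_nonneg h2, abs_of_pos h3]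
          exact ⟨rfl, by linarith⟩
        · have h3 : p (j + 1) * q (j + 1) < 0 := by
            by_contra hcon
            nlinarith
          rw [sg_of_neg h2, sg_of_neg h3, abs_of_neg h2, abs_of_neg h3]
          exact ⟨rfl, by linarith⟩
        · rw [sg_of_nonneg h1, sg_of_nonneg h2] at hne; exact absurd rfl hne
      refine ⟨hboth.1, ?_⟩
      rw [← hboth.1]
      apply sg_eq_of_mul_pos
      simp only [hI]
      rw [re_conj_mul_solVec]
      refine inner_mul_pos_of_wronskian_small (hp j) (hq j) hd hd0.le ?_
      refine le_trans (le_of_eq ?_) hboth.2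
      simp only [hw, ← hpdef, ← hqdef]
      congr 1
      ring
    · intro hlt
      exact sg_eq_of_mul_pos (hm j hlt)
  have hΨb : ∀ j, -(3 / 2) ≤ Ψ j ∧ Ψ j ≤ 1 / 2 := by
    intro j
    simp only [hΨ]
    rcases sg_eq (w j) with h1 | h1 <;> rcases sg_eq (p (j + 1) * q (j + 1)) with h2 | h2 <;>
    rcases sg_eq (I j) with h3 | h3 <;> rw [h1, h2, h3] <;> norm_num
  calc _ ≤ ∑ j ∈ Finset.range n, (m j + (Ψ (j + 1) - Ψ j)) := Finset.sum_le_sum fun j _ => hstep j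
    _ = ∑ j ∈ Finset.range n, m j + (Ψ n - Ψ 0) := by
        rw [Finset.sum_add_distrib, Finset.sum_range_sub]
    _ ≤ _ := by linarith [(hΨb n).2, (hΨb 0).1]

/-- Two vectors whose inner product changes sign in one step are almost orthogonal. -/
lemma StepParams.one_le_lyapunov_of_inner_nonpos {r τ g T h : ℝ} {ζ : ℂ}
    (H : StepParams r τ g T h ζ) {x y : ℂ} (hx : x ≠ 0) (hy : y ≠ 0) {t : ℝ} (ht : |t| ≤ T)
    (hI : ((starRingEnd ℂ) x * y).re *
      ((starRingEnd ℂ) (shear t (ζ * x)) * shear (t - h) (ζ * y)).re ≤ 0) :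
    1 ≤ 1.1 * lyapunov r τ ζ x y := by
  have hT := H.T_le'
  have hT0 := H.T_nonneg
  have hxp : 0 < ‖x‖ := norm_pos_iff.mpr hx
  have hyp : 0 < ‖y‖ := norm_pos_iff.mpr hy
  have hth : |t - h| ≤ 1.01 * T := by
    refine (abs_sub _ _).trans ?_
    rw [abs_of_nonneg H.h_nonneg]
    linarith [H.h_le]
  have hcc : (starRingEnd ℂ) ζ * ζ = 1 := by
    rw [mul_comm, Complex.mul_conj, Complex.normSq_eq_norm_sq, H.norm_ζ]; simp
  have hrot : (starRingEnd ℂ) (ζ * x) * (ζ * y) = (starRingEnd ℂ) x * y := by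
    rw [map_mul]
    linear_combination ((starRingEnd ℂ) x * y) * hcc
  have hux : ‖ζ * x‖ = ‖x‖ := by rw [norm_mul, H.norm_ζ, one_mul]
  have huy : ‖ζ * y‖ = ‖y‖ := by rw [norm_mul, H.norm_ζ, one_mul]
  set I := ((starRingEnd ℂ) x * y).re with hIdef
  set J := ((starRingEnd ℂ) (shear t (ζ * x)) * shear (t - h) (ζ * y)).re with hJdef
  have hIJ : |J - I| ≤ 0.01 * (‖x‖ * ‖y‖) := by
    have d1 := norm_shear_sub_le t (ζ * x)
    have d2 := norm_shear_sub_le (t - h) (ζ * y)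
    rw [hux] at d1
    rw [huy] at d2
    rw [hJdef, hIdef, ← hrot, ← Complex.sub_re]
    refine (Complex.abs_re_le_norm _).trans ?_
    set δ₁ := shear t (ζ * x) - ζ * x with hδ₁
    set δ₂ := shear (t - h) (ζ * y) - ζ * y with hδ₂
    have e : (starRingEnd ℂ) (shear t (ζ * x)) * shear (t - h) (ζ * y) -
        (starRingEnd ℂ) (ζ * x) * (ζ * y) =
        (starRingEnd ℂ) δ₁ * (ζ * y) + (starRingEnd ℂ) (ζ * x) * δ₂ +
          (starRingEnd ℂ) δ₁ * δ₂ := by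
      rw [hδ₁, hδ₂, map_sub]; ring
    rw [e]
    refine (norm_add₃_le).trans ?_
    rw [norm_mul ((starRingEnd ℂ) δ₁) (ζ * y), norm_mul ((starRingEnd ℂ) (ζ * x)) δ₂,
      norm_mul ((starRingEnd ℂ) δ₁) δ₂, RCLike.norm_conj, RCLike.norm_conj, hux, huy]
    have d1' : ‖δ₁‖ ≤ 1 / 345 * ‖x‖ := d1.trans (by gcongr; linarith)
    have d2' : ‖δ₂‖ ≤ 1.01 / 345 * ‖y‖ := d2.trans (by gcongr; linarith)
    calc _ ≤ 1 / 345 * ‖x‖ * ‖y‖ + ‖x‖ * (1.01 / 345 * ‖y‖) +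
          1 / 345 * ‖x‖ * (1.01 / 345 * ‖y‖) := by gcongr
      _ ≤ 0.01 * (‖x‖ * ‖y‖) := by
          have : 0 ≤ ‖x‖ * ‖y‖ := by positivity
          nlinarith
  have hIsmall : |I| ≤ 0.01 * (‖x‖ * ‖y‖) := by
    refine le_trans ?_ hIJ
    rw [← sq_le_sq]
    nlinarith [sq_nonneg J]
  have hsin : 0.98 ≤ sinAngle x y := by
    rw [sinAngle, le_div_iff₀ (by positivity)]
    have hn : I ^ 2 + ((starRingEnd ℂ) x * y).im ^ 2 = (‖x‖ * ‖y‖) ^ 2 := by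
      have := Complex.normSq_apply ((starRingEnd ℂ) x * y)
      rw [Complex.normSq_eq_norm_sq, norm_mul, RCLike.norm_conj] at this
      rw [this]; ring
    have hI2 : I ^ 2 ≤ (0.01 * (‖x‖ * ‖y‖)) ^ 2 := by
      rw [← sq_abs]
      exact pow_le_pow_left₀ (abs_nonneg _) hIsmall 2
    have hN : 0 ≤ 0.98 * (‖x‖ * ‖y‖) := by positivity
    rw [← abs_of_nonneg hN]
    apply sq_le_sq.mp
    nlinarith
  have hpow : 0.98 ≤ sinAngle x y ^ (2 * r) := by
    calc (0.98 : ℝ) ≤ sinAngle x y := hsin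
      _ = sinAngle x y ^ (1 : ℝ) := (Real.rpow_one _).symm
      _ ≤ _ := Real.rpow_le_rpow_of_exponent_ge (by linarith) (sinAngle_le_one _ _)
          (by linarith [H.r_le])
  have hexp := H.le_exp_corrector x y
  have : (0.98 : ℝ) * 0.99 ≤ lyapunov r τ ζ x y := by unfold lyapunov; gcongr
  linarith

/-! ### Inertia -/

section Inertia
open Matrix

variable {n : ℕ}

lemma dotProduct_self_eq_sum_sq {A : Matrix (Fin n) (Fin n) ℝ} (hA : A.IsHermitian)
    (ψ : Fin n → ℝ) : ψ ⬝ᵥ ψ = ∑ i, (⇑(hA.eigenvectorBasis i) ⬝ᵥ ψ) ^ 2 := by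
  have h := hA.eigenvectorBasis.sum_sq_norm_inner_right (WithLp.toLp 2 ψ)
  simp only [EuclideanSpace.norm_sq_eq, EuclideanSpace.inner_eq_star_dotProduct,
    Real.norm_eq_abs, sq_abs, star_trivial] at h
  rw [dotProduct]
  simp only [← pow_two]
  rw [← h]
  refine Finset.sum_congr rfl fun i _ => ?_
  rw [dotProduct_comm]

lemma dotProduct_mulVec_eq_sum {A : Matrix (Fin n) (Fin n) ℝ} (hA : A.IsHermitian)
    (ψ : Fin n → ℝ) :
    ψ ⬝ᵥ A *ᵥ ψ = ∑ i, hA.eigenvalues i * (⇑(hA.eigenvectorBasis i) ⬝ᵥ ψ) ^ 2 := by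
  have h := hA.eigenvectorBasis.sum_inner_mul_inner (WithLp.toLp 2 ψ) (WithLp.toLp 2 (A *ᵥ ψ))
  simp only [EuclideanSpace.inner_eq_star_dotProduct, star_trivial] at h
  rw [dotProduct_comm, ← h]
  refine Finset.sum_congr rfl fun i _ => ?_
  have hs : Aᵀ = A := by simpa [conjTranspose_eq_transpose_of_trivial] using hA.eq
  have e : (A *ᵥ ψ) ⬝ᵥ ⇑(hA.eigenvectorBasis i) =
      hA.eigenvalues i * (⇑(hA.eigenvectorBasis i) ⬝ᵥ ψ) := by
    rw [dotProduct_comm, dotProduct_mulVec, ← mulVec_transpose, hs, hA.mulVec_eigenvectorBasis,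
      smul_dotProduct, smul_eq_mul]
  rw [e]
  ring

/-- One half of Sylvester's law of inertia: if `ε (E - A)` is nonnegative on the kernel of `#s`
linear functionals, then at least `n - #s` eigenvalues `μ` of `A` satisfy `ε (E - μ) ≥ 0`. -/
lemma le_card_add_card_eigenvalues {A : Matrix (Fin n) (Fin n) ℝ} (hA : A.IsHermitian) (E ε : ℝ)
    {s : Finset (Fin n)} (L : (Fin n → ℝ) →ₗ[ℝ] (s → ℝ))
    (hL : ∀ ψ, L ψ = 0 → 0 ≤ ε * (E * (ψ ⬝ᵥ ψ) - ψ ⬝ᵥ A *ᵥ ψ)) :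
    n ≤ s.card + (Finset.univ.filter fun i => 0 ≤ ε * (E - hA.eigenvalues i)).card := by
  by_contra hcon
  push Not at hcon
  set t := Finset.univ.filter fun i => 0 ≤ ε * (E - hA.eigenvalues i) with ht
  let M : (Fin n → ℝ) →ₗ[ℝ] (t → ℝ) :=
    LinearMap.pi fun i => dotProductBilin ℝ ℝ (⇑(hA.eigenvectorBasis i) : Fin n → ℝ)
  have hker : (L.prod M).ker ≠ ⊥ := by
    apply LinearMap.ker_ne_bot_of_finrank_lt
    simpa using hcon
  obtain ⟨ψ, hψ, hψ0⟩ := Submodule.exists_mem_ne_zero_of_ne_bot hker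
  have hψ' : L ψ = 0 ∧ M ψ = 0 := by
    simpa [LinearMap.mem_ker, Prod.ext_iff] using hψ
  have hM : ∀ i ∈ t, ⇑(hA.eigenvectorBasis i) ⬝ᵥ ψ = 0 := fun i hi =>
    congrFun hψ'.2 ⟨i, hi⟩
  have h1 := hL ψ hψ'.1
  rw [dotProduct_self_eq_sum_sq hA, dotProduct_mulVec_eq_sum hA, Finset.mul_sum,
    ← Finset.sum_sub_distrib, Finset.mul_sum] at h1
  have hterm : ∀ i ∈ Finset.univ, ε * (E * (⇑(hA.eigenvectorBasis i) ⬝ᵥ ψ) ^ 2 -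
      hA.eigenvalues i * (⇑(hA.eigenvectorBasis i) ⬝ᵥ ψ) ^ 2) ≤ 0 := by
    intro i _
    by_cases hi : i ∈ t
    · rw [hM i hi]; simp
    · have : ε * (E - hA.eigenvalues i) < 0 := by simpa [ht] using hi
      nlinarith [sq_nonneg (⇑(hA.eigenvectorBasis i) ⬝ᵥ ψ)]
  have hzero := (Finset.sum_eq_zero_iff_of_nonpos hterm).mp
    (le_antisymm (Finset.sum_nonpos hterm) h1)
  have hall : ∀ i, ⇑(hA.eigenvectorBasis i) ⬝ᵥ ψ = 0 := by
    intro i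
    by_cases hi : i ∈ t
    · exact hM i hi
    · have h2 : ε * (E - hA.eigenvalues i) < 0 := by simpa [ht] using hi
      have h3 := hzero i (Finset.mem_univ i)
      have h4 : ε * (E - hA.eigenvalues i) * (⇑(hA.eigenvectorBasis i) ⬝ᵥ ψ) ^ 2 = 0 := by
        rw [← h3]; ring
      exact pow_eq_zero_iff two_ne_zero |>.mp ((mul_eq_zero.mp h4).resolve_left h2.ne)
  have hself : ψ ⬝ᵥ ψ = 0 := by
    rw [dotProduct_self_eq_sum_sq hA]
    exact Finset.sum_eq_zero fun i _ => by rw [hall i]; norm_num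
  exact hψ0 (dotProduct_self_eq_zero.mp hself)

/-- Extension of a vector on `{0, …, n - 1}` by zero. -/
def extendZero : (Fin n → ℝ) →ₗ[ℝ] (ℕ → ℝ) where
  toFun ψ k := if h : k < n then ψ ⟨k, h⟩ else 0
  map_add' ψ χ := by
    ext k; by_cases h : k < n <;> simp [h]
  map_smul' c ψ := by
    ext k; by_cases h : k < n <;> simp [h]

lemma extendZero_fin (ψ : Fin n → ℝ) (i : Fin n) : extendZero ψ i = ψ i := by
  simp [extendZero]

lemma extendZero_self (ψ : Fin n → ℝ) : extendZero ψ n = 0 := by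
  simp [extendZero]

lemma sum_ite_eq_succ (ψ : Fin n → ℝ) (i : Fin n) :
    ∑ j : Fin n, (if (j : ℕ) = i + 1 then ψ j else 0) = extendZero ψ (i + 1) := by
  by_cases h : (i : ℕ) + 1 < n
  · have : ∀ j : Fin n, ((j : ℕ) = i + 1) ↔ j = ⟨i + 1, h⟩ := fun j => by simp [Fin.ext_iff]
    simp [this, extendZero, h]
  · have : ∀ j : Fin n, ¬ ((j : ℕ) = i + 1) := fun j hj => h (hj ▸ j.2)
    simp [this, extendZero, h]

lemma boxMatrix_apply (σ : ℝ) (v : ℤ → ℝ) (i j : Fin n) :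
    boxMatrix σ v n i j = (if i = j then σ * v (i + 1) else 0) +
      (if (j : ℕ) = i + 1 then 1 else 0) + (if (i : ℕ) = j + 1 then 1 else 0) := by
  simp only [boxMatrix, andersonMatrix, submatrix_apply, Fin.ext_iff]
  by_cases h1 : (i : ℕ) = j
  · simp [h1]
  · have h1' : ¬ ((i : ℤ) + 1 = j + 1) := by omega
    rw [if_neg h1', if_neg h1]
    by_cases h2 : (j : ℕ) = i + 1
    · have h3 : ¬ ((i : ℕ) = j + 1) := by omega
      have h4 : |((i : ℤ) + 1) - (j + 1)| = 1 := by
        rw [show ((i : ℤ) + 1) - (j + 1) = -1 by omega]; norm_num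
      rw [if_pos h4, if_pos h2, if_neg h3]; norm_num
    · by_cases h3 : (i : ℕ) = j + 1
      · have h4 : |((i : ℤ) + 1) - (j + 1)| = 1 := by
          rw [show ((i : ℤ) + 1) - (j + 1) = 1 by omega]; norm_num
        rw [if_pos h4, if_neg h2, if_pos h3]; norm_num
      · have h4 : ¬ |((i : ℤ) + 1) - (j + 1)| = 1 := by
          intro h
          rcases (abs_eq (by norm_num : (0 : ℤ) ≤ 1)).mp h with h | h <;> omega
        rw [if_neg h4, if_neg h2, if_neg h3]; norm_num

lemma dotProduct_boxMatrix_mulVec (σ : ℝ) (v : ℤ → ℝ) (ψ : Fin n → ℝ) :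
    ψ ⬝ᵥ boxMatrix σ v n *ᵥ ψ =
      ∑ i ∈ Finset.range n, (σ * v (i + 1) * extendZero ψ i ^ 2 +
        2 * (extendZero ψ i * extendZero ψ (i + 1))) := by
  have hsum : ψ ⬝ᵥ boxMatrix σ v n *ᵥ ψ = ∑ i : Fin n, ∑ j : Fin n,
      ((if i = j then σ * v (i + 1) * (ψ i * ψ j) else 0) +
        ψ i * (if (j : ℕ) = i + 1 then ψ j else 0) +
        ψ j * (if (i : ℕ) = j + 1 then ψ i else 0)) := by
    simp only [dotProduct, mulVec, Finset.mul_sum]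
    refine Finset.sum_congr rfl fun i _ => Finset.sum_congr rfl fun j _ => ?_
    rw [boxMatrix_apply]
    split_ifs <;> ring
  rw [hsum]
  simp only [Finset.sum_add_distrib]
  rw [Finset.sum_comm (f := fun i j : Fin n => ψ j * (if (i : ℕ) = j + 1 then ψ i else 0))]
  simp only [← Finset.mul_sum, sum_ite_eq_succ, Finset.sum_ite_eq, Finset.mem_univ, if_true]
  rw [← Finset.sum_add_distrib, ← Finset.sum_add_distrib, Finset.mul_sum, ← Finset.sum_add_distrib,
    Finset.sum_range]
  refine Finset.sum_congr rfl fun i _ => ?_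
  rw [extendZero_fin]
  ring

lemma dotProduct_self_eq_sum_extendZero (ψ : Fin n → ℝ) :
    ψ ⬝ᵥ ψ = ∑ i ∈ Finset.range n, extendZero ψ i ^ 2 := by
  rw [Finset.sum_range, dotProduct]
  refine Finset.sum_congr rfl fun i _ => ?_
  rw [extendZero_fin, pow_two]

/-- Completion of squares: the pivots of `E - H` are the ratios of consecutive values of the
solution at energy `E`. -/
lemma sub_dotProduct_boxMatrix_eq (σ E : ℝ) (v : ℤ → ℝ)
    (hp : ∀ j, sol σ E (fun k => v (k + 1)) (j + 1) ≠ 0) (ψ : Fin n → ℝ) :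
    E * (ψ ⬝ᵥ ψ) - ψ ⬝ᵥ boxMatrix σ v n *ᵥ ψ = ∑ j ∈ Finset.range n,
      sol σ E (fun k => v (k + 1)) (j + 2) / sol σ E (fun k => v (k + 1)) (j + 1) *
        (extendZero ψ j - extendZero ψ (j + 1) /
          (sol σ E (fun k => v (k + 1)) (j + 2) / sol σ E (fun k => v (k + 1)) (j + 1))) ^ 2 := by
  set p := sol σ E (fun k => v (k + 1)) with hpdef
  rw [dotProduct_self_eq_sum_extendZero, dotProduct_boxMatrix_mulVec, Finset.mul_sum,
    ← Finset.sum_sub_distrib]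
  -- Gaussian elimination on the first `m` coordinates leaves one term at site `m`, which vanishes
  -- at the end of the box because the extended vector is zero there.
  have key : ∀ m, ∑ i ∈ Finset.range m, (E * extendZero ψ i ^ 2 -
      (σ * v (i + 1) * extendZero ψ i ^ 2 + 2 * (extendZero ψ i * extendZero ψ (i + 1)))) =
      ∑ j ∈ Finset.range m, p (j + 2) / p (j + 1) *
        (extendZero ψ j - extendZero ψ (j + 1) / (p (j + 2) / p (j + 1))) ^ 2 -
      p m / p (m + 1) * extendZero ψ m ^ 2 := by
    intro m
    induction m with
    | zero => simp [hpdef]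
    | succ m ih =>
      rw [Finset.sum_range_succ, Finset.sum_range_succ, ih]
      have h1 : p (m + 1) ≠ 0 := hp m
      have h2 : p (m + 2) ≠ 0 := hp (m + 1)
      have h3 : p (m + 2) = (E - σ * v (m + 1)) * p (m + 1) - p m := by
        rw [hpdef, sol_add_two]
      have h4 : p m = (E - σ * v (m + 1)) * p (m + 1) - p (m + 2) := by rw [h3]; ring
      rw [h4, show m + 1 + 1 = m + 2 by ring]
      field_simp
      ring
  rw [key n, extendZero_self]
  ring

/-- The functionals are the squares, in `sub_dotProduct_boxMatrix_eq`, whose pivots have the sign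
opposite to `ε`; on their common kernel only terms with the sign of `ε` remain. -/
lemma le_card_add_card_eigenvalues_boxMatrix (σ E ε : ℝ) (v : ℤ → ℝ)
    (hp : ∀ j, sol σ E (fun k => v (k + 1)) (j + 1) ≠ 0) :
    n ≤ (Finset.univ.filter fun j : Fin n => ε * (sol σ E (fun k => v (k + 1)) (j + 2) *
        sol σ E (fun k => v (k + 1)) (j + 1)) < 0).card +
      (Finset.univ.filter fun i =>
        0 ≤ ε * (E - (boxMatrix_isHermitian σ v n).eigenvalues i)).card := by
  set p := sol σ E (fun k => v (k + 1)) with hpdef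
  set s := Finset.univ.filter fun j : Fin n => ε * (p (j + 2) * p (j + 1)) < 0 with hs
  let L : (Fin n → ℝ) →ₗ[ℝ] (s → ℝ) := LinearMap.pi fun j =>
    (LinearMap.proj (j : ℕ) - (p (j + 2) / p (j + 1))⁻¹ • LinearMap.proj ((j : ℕ) + 1)) ∘ₗ extendZero
  refine le_card_add_card_eigenvalues (boxMatrix_isHermitian σ v n) E ε L fun ψ hψ => ?_
  rw [sub_dotProduct_boxMatrix_eq σ E v hp ψ, Finset.mul_sum, Finset.sum_range]
  refine Finset.sum_nonneg fun j _ => ?_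
  by_cases hj : j ∈ s
  · have h := congrFun hψ ⟨j, hj⟩
    have h' : extendZero ψ j - extendZero ψ (j + 1) / (p (j + 2) / p (j + 1)) = 0 := by
      simpa [L, div_eq_inv_mul] using h
    rw [← hpdef, h']
    simp
  · have h : 0 ≤ ε * (p (j + 2) * p (j + 1)) := by simpa [hs] using hj
    have h1 : p (j + 1) ≠ 0 := hp j
    have h2 : 0 ≤ ε * (p (j + 2) / p (j + 1)) := by
      have : ε * (p (j + 2) / p (j + 1)) = ε * (p (j + 2) * p (j + 1)) / p (j + 1) ^ 2 := by
        field_simp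
      rw [this]; positivity
    rw [← hpdef, ← mul_assoc]
    positivity

/-- The number of eigenvalues of the box matrix in an open interval is bounded by the difference of
the sign-agreement counts of the solutions at its end points. -/
lemma card_eigenvalues_Ioo_le (σ : ℝ) {a b : ℝ} (hab : a < b) (v : ℤ → ℝ)
    (hp : ∀ j, sol σ a (fun k => v (k + 1)) (j + 1) ≠ 0)
    (hq : ∀ j, sol σ b (fun k => v (k + 1)) (j + 1) ≠ 0) :
    ((Finset.univ.filter fun i =>
      (boxMatrix_isHermitian σ v n).eigenvalues i ∈ Set.Ioo a b).card : ℝ) ≤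
    ∑ j ∈ Finset.range n,
      ((if 0 < sol σ b (fun k => v (k + 1)) (j + 2) * sol σ b (fun k => v (k + 1)) (j + 1)
        then 1 else 0 : ℝ) -
      (if 0 < sol σ a (fun k => v (k + 1)) (j + 2) * sol σ a (fun k => v (k + 1)) (j + 1)
        then 1 else 0)) := by
  have h1 := le_card_add_card_eigenvalues_boxMatrix (n := n) σ a 1 v hp
  have h2 := le_card_add_card_eigenvalues_boxMatrix (n := n) σ b (-1) v hq
  set p := sol σ a (fun k => v (k + 1)) with hpdef
  set q := sol σ b (fun k => v (k + 1)) with hqdef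
  set l := (boxMatrix_isHermitian σ v n).eigenvalues
  simp only [one_mul, neg_mul, sub_nonneg, neg_sub, Left.neg_neg_iff] at h1 h2
  have h3 : (Finset.univ.filter fun j : Fin n => p (j + 2) * p (j + 1) < 0).card +
      (Finset.univ.filter fun j : Fin n => 0 < p (j + 2) * p (j + 1)).card = n := by
    have e : (Finset.univ.filter fun j : Fin n => p (j + 2) * p (j + 1) < 0) =
        Finset.univ.filter fun j : Fin n => ¬ 0 < p (j + 2) * p (j + 1) := by
      refine Finset.filter_congr fun j _ => ?_
      rw [not_lt]
      exact ⟨le_of_lt, fun h => lt_of_le_of_ne h (mul_ne_zero (hp (j + 1)) (hp j))⟩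
    rw [e, add_comm, Finset.card_filter_add_card_filter_not, Finset.card_univ, Fintype.card_fin]
  have h4 : (Finset.univ.filter fun i : Fin n => l i ∈ Set.Ioo a b).card +
      (Finset.univ.filter fun i : Fin n => l i ≤ a).card +
      (Finset.univ.filter fun i : Fin n => b ≤ l i).card ≤ n := by
    rw [Finset.card_filter, Finset.card_filter, Finset.card_filter, ← Finset.sum_add_distrib,
      ← Finset.sum_add_distrib]
    calc _ ≤ ∑ _i : Fin n, 1 := by
          refine Finset.sum_le_sum fun i _ => ?_
          by_cases k1 : l i ≤ a
          · have k2 : ¬ b ≤ l i := by linarith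
            have k3 : ¬ l i ∈ Set.Ioo a b := fun h => by linarith [h.1]
            simp [k1, k2, k3]
          · by_cases k2 : b ≤ l i
            · have k3 : ¬ l i ∈ Set.Ioo a b := fun h => by linarith [h.2]
              simp [k1, k2, k3]
            · simp only [k1, k2, if_false, add_zero]
              split_ifs <;> norm_num
      _ = n := by simp
  rw [Finset.sum_sub_distrib, Finset.sum_range, Finset.sum_range, Finset.sum_boole,
    Finset.sum_boole, le_sub_iff_add_le]
  have hle : (Finset.univ.filter fun i : Fin n => l i ∈ Set.Ioo a b).card +
      (Finset.univ.filter fun j : Fin n => 0 < p (j + 2) * p (j + 1)).card ≤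
      (Finset.univ.filter fun j : Fin n => 0 < q (j + 2) * q (j + 1)).card := by
    omega
  exact_mod_cast hle
end Inertia

/-! ### Moments of the empirical eigenvalue distributions -/

section Moments
open Matrix

variable {n : ℕ}

lemma integral_empiricalEigenvalueMeasure (σ : ℝ) (v : ℤ → ℝ) (n : ℕ) (f : ℝ → ℝ) :
    ∫ x, f x ∂(empiricalEigenvalueMeasure σ v n) =
      (∑ i, f ((boxMatrix_isHermitian σ v n).eigenvalues i)) / n := by
  rw [empiricalEigenvalueMeasure, integral_smul_measure,
    integral_finsetSum_measure fun i _ => integrable_dirac (by simp)]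
  simp [integral_dirac, div_eq_inv_mul]

lemma isProbabilityMeasure_empiricalEigenvalueMeasure (σ : ℝ) (v : ℤ → ℝ) (n : ℕ) :
    IsProbabilityMeasure (empiricalEigenvalueMeasure σ v (n + 1)) := by
  constructor
  simp only [empiricalEigenvalueMeasure, Measure.smul_apply, Measure.coe_finsetSum,
    Finset.sum_apply, measure_univ, Finset.sum_const, Finset.card_univ, Fintype.card_fin,
    smul_eq_mul, nsmul_eq_mul, mul_one]
  exact ENNReal.inv_mul_cancel (by simp) (ENNReal.natCast_ne_top _)

lemma sum_eigenvalues_pow_eq_trace {A : Matrix (Fin n) (Fin n) ℝ} (hA : A.IsHermitian) (k : ℕ) :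
    ∑ i, hA.eigenvalues i ^ k = (A ^ k).trace := by
  conv_rhs => rw [hA.spectral_theorem, ← map_pow, Unitary.conjStarAlgAut_apply, trace_mul_comm,
    ← mul_assoc, Unitary.coe_star_mul_self, one_mul, diagonal_pow, trace_diagonal]
  simp

lemma sum_abs_boxMatrix_le {σ c₀ : ℝ} (hσ : 0 ≤ σ) {v : ℤ → ℝ} (hv : ∀ i, |v i| ≤ c₀)
    (i : Fin n) : ∑ j, |boxMatrix σ v n i j| ≤ 2 + σ * c₀ := by
  have h1 : ∑ j : Fin n, (if i = j then σ * c₀ else 0) = σ * c₀ := by simp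
  have hcard : ∀ s : Finset (Fin n), (∀ a ∈ s, ∀ b ∈ s, a = b) → ((s.card : ℕ) : ℝ) ≤ 1 := by
    intro s hs
    exact_mod_cast Finset.card_le_one.mpr hs
  have h2 : ∑ j : Fin n, (if (j : ℕ) = i + 1 then 1 else 0 : ℝ) ≤ 1 := by
    rw [Finset.sum_boole]
    refine hcard _ fun a ha b hb => Fin.ext ?_
    simp at ha hb
    omega
  have h3 : ∑ j : Fin n, (if (i : ℕ) = j + 1 then 1 else 0 : ℝ) ≤ 1 := by
    rw [Finset.sum_boole]
    refine hcard _ fun a ha b hb => Fin.ext ?_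
    simp at ha hb
    omega
  calc _ ≤ ∑ j : Fin n, ((if i = j then σ * c₀ else 0) + (if (j : ℕ) = i + 1 then 1 else 0) +
        (if (i : ℕ) = j + 1 then 1 else 0)) := by
        refine Finset.sum_le_sum fun j _ => ?_
        rw [boxMatrix_apply]
        refine (abs_add_le _ _).trans (add_le_add ((abs_add_le _ _).trans (add_le_add ?_ ?_)) ?_)
        · split_ifs
          · rw [abs_mul, abs_of_nonneg hσ]
            exact mul_le_mul_of_nonneg_left (hv _) hσ
          · simp
        · split_ifs <;> simp
        · split_ifs <;> simp
    _ ≤ _ := by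
        rw [Finset.sum_add_distrib, Finset.sum_add_distrib, h1]
        linarith

lemma abs_eigenvalues_le {σ c₀ : ℝ} (hσ : 0 ≤ σ) {v : ℤ → ℝ} (hv : ∀ i, |v i| ≤ c₀) (i : Fin n) :
    |(boxMatrix_isHermitian σ v n).eigenvalues i| ≤ 2 + σ * c₀ := by
  set hA := boxMatrix_isHermitian σ v n
  have hev : Module.End.HasEigenvalue (Matrix.toLin' (boxMatrix σ v n)) (hA.eigenvalues i) := by
    refine Module.End.hasEigenvalue_of_hasEigenvector (x := ⇑(hA.eigenvectorBasis i))
      ⟨Module.End.mem_eigenspace_iff.mpr ?_, ?_⟩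
    · rw [toLin'_apply, hA.mulVec_eigenvectorBasis]
    · intro h0
      apply hA.eigenvectorBasis.orthonormal.ne_zero i
      ext k
      exact congrFun h0 k
  obtain ⟨k, hk⟩ := eigenvalue_mem_ball hev
  rw [Metric.mem_closedBall, Real.dist_eq] at hk
  have hsum := sum_abs_boxMatrix_le hσ hv k
  rw [← Finset.add_sum_erase _ _ (Finset.mem_univ k)] at hsum
  simp only [Real.norm_eq_abs] at hk
  have := abs_sub_abs_le_abs_sub (hA.eigenvalues i) (boxMatrix σ v n k k)
  linarith

lemma empiricalEigenvalueMeasure_compl_Icc {σ c₀ : ℝ} (hσ : 0 ≤ σ) {v : ℤ → ℝ}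
    (hv : ∀ i, |v i| ≤ c₀) (n : ℕ) :
    empiricalEigenvalueMeasure σ v n (Set.Icc (-(2 + σ * c₀)) (2 + σ * c₀))ᶜ = 0 := by
  simp only [empiricalEigenvalueMeasure, Measure.smul_apply, Measure.coe_finsetSum,
    Finset.sum_apply, smul_eq_mul]
  rw [Finset.sum_eq_zero fun i _ => ?_, mul_zero]
  rw [Measure.dirac_apply' _ measurableSet_Icc.compl, Set.indicator_of_notMem]
  rw [Set.notMem_compl_iff]
  exact abs_le.mp (abs_eigenvalues_le hσ hv i)

/-- The entries `⟨δ_m, H^k δ_0⟩` of the powers of the bi-infinite operator `H` with potential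
`σ u`. -/
def walk (σ : ℝ) (u : ℤ → ℝ) : ℕ → ℤ → ℝ
  | 0, m => if m = 0 then 1 else 0
  | (k + 1), m => walk σ u k (m - 1) + walk σ u k (m + 1) + σ * u m * walk σ u k m

lemma walk_eq_zero (σ : ℝ) (u : ℤ → ℝ) (k : ℕ) {m : ℤ} (hm : (k : ℤ) < |m|) :
    walk σ u k m = 0 := by
  induction k generalizing m with
  | zero =>
    have : m ≠ 0 := by rintro rfl; simp at hm
    simp [walk, this]
  | succ k ih =>
    push_cast at hm
    have h1 : (k : ℤ) < |m - 1| := by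
      rcases lt_abs.mp hm with h | h
      · exact lt_abs.mpr (Or.inl (by omega))
      · exact lt_abs.mpr (Or.inr (by omega))
    have h2 : (k : ℤ) < |m + 1| := by
      rcases lt_abs.mp hm with h | h
      · exact lt_abs.mpr (Or.inl (by omega))
      · exact lt_abs.mpr (Or.inr (by omega))
    rw [walk, ih h1, ih h2, ih (by omega)]
    ring

lemma abs_walk_le {σ c₀ : ℝ} (hσ : 0 ≤ σ) {u : ℤ → ℝ} (hu : ∀ i, |u i| ≤ c₀) (k : ℕ) (m : ℤ) :
    |walk σ u k m| ≤ (2 + σ * c₀) ^ k := by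
  induction k generalizing m with
  | zero =>
    rw [walk]; split_ifs <;> simp
  | succ k ih =>
    rw [walk, pow_succ]
    have h3 : |σ * u m * walk σ u k m| ≤ σ * c₀ * (2 + σ * c₀) ^ k := by
      rw [abs_mul, abs_mul, abs_of_nonneg hσ]
      have hR := (abs_nonneg _).trans (ih m)
      have hc := (abs_nonneg _).trans (hu m)
      gcongr
      · exact hu m
      · exact ih m
    calc _ ≤ |walk σ u k (m - 1)| + |walk σ u k (m + 1)| + |σ * u m * walk σ u k m| :=
          abs_add_three _ _ _
      _ ≤ (2 + σ * c₀) ^ k + (2 + σ * c₀) ^ k + σ * c₀ * (2 + σ * c₀) ^ k := by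
          gcongr
          · exact ih _
          · exact ih _
      _ = _ := by ring

lemma abs_boxMatrix_pow_le {σ c₀ : ℝ} (hσ : 0 ≤ σ) {v : ℤ → ℝ} (hv : ∀ i, |v i| ≤ c₀) (k : ℕ)
    (j i : Fin n) : |(boxMatrix σ v n ^ k) j i| ≤ (2 + σ * c₀) ^ k := by
  induction k generalizing j with
  | zero =>
    rw [pow_zero, pow_zero, one_apply]; split_ifs <;> simp
  | succ k ih =>
    have hR : 0 ≤ (2 + σ * c₀) ^ k := (abs_nonneg _).trans (ih i)
    rw [pow_succ', mul_apply, pow_succ']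
    calc _ ≤ ∑ l, |boxMatrix σ v n j l * (boxMatrix σ v n ^ k) l i| :=
          Finset.abs_sum_le_sum_abs _ _
      _ ≤ ∑ l, |boxMatrix σ v n j l| * (2 + σ * c₀) ^ k := by
          refine Finset.sum_le_sum fun l _ => ?_
          rw [abs_mul]
          exact mul_le_mul_of_nonneg_left (ih l) (abs_nonneg _)
      _ ≤ _ := by
          rw [← Finset.sum_mul]
          exact mul_le_mul_of_nonneg_right (sum_abs_boxMatrix_le hσ hv j) hR

/-- Away from the boundary of the box, the powers of the box matrix agree with those of the
bi-infinite operator. -/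
lemma boxMatrix_pow_apply (σ : ℝ) (v : ℤ → ℝ) (k : ℕ) {i : Fin n} (hi : k ≤ (i : ℕ))
    (hin : (i : ℕ) + k < n) (j : Fin n) :
    (boxMatrix σ v n ^ k) j i = walk σ (fun m => v (m + i + 1)) k ((j : ℤ) - i) := by
  induction k generalizing j with
  | zero =>
    rw [pow_zero, one_apply, walk]
    simp [sub_eq_zero, Fin.ext_iff]
  | succ k ih =>
    have ih' := ih (by omega) (by omega)
    rw [pow_succ', mul_apply, walk]
    simp only [ih', boxMatrix_apply, add_mul, Finset.sum_add_distrib, ite_mul, zero_mul, one_mul]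
    rw [Finset.sum_ite_eq, if_pos (Finset.mem_univ j)]
    have h1 : ∑ l : Fin n, (if (l : ℕ) = j + 1 then
        walk σ (fun m => v (m + i + 1)) k ((l : ℤ) - i) else 0) =
        walk σ (fun m => v (m + i + 1)) k ((j : ℤ) - i + 1) := by
      by_cases h : (j : ℕ) + 1 < n
      · rw [Finset.sum_eq_single (⟨j + 1, h⟩ : Fin n)]
        · simp only [if_true]
          congr 1
          push_cast
          ring
        · intro b _ hb
          rw [if_neg]
          exact fun hc => hb (Fin.ext hc)
        · simp
      · rw [Finset.sum_eq_zero, walk_eq_zero]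
        · rw [lt_abs]; left; omega
        · intro b _
          rw [if_neg]; omega
    have h2 : ∑ l : Fin n, (if (j : ℕ) = l + 1 then
        walk σ (fun m => v (m + i + 1)) k ((l : ℤ) - i) else 0) =
        walk σ (fun m => v (m + i + 1)) k ((j : ℤ) - i - 1) := by
      by_cases h : 0 < (j : ℕ)
      · rw [Finset.sum_eq_single (⟨j - 1, by omega⟩ : Fin n)]
        · rw [if_pos (by simp only; omega)]
          congr 1
          simp only
          omega
        · intro b _ hb
          rw [if_neg]
          intro hc
          exact hb (Fin.ext (by simp only; omega))
        · simp
      · rw [Finset.sum_eq_zero, walk_eq_zero]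
        · rw [lt_abs]; right; omega
        · intro b _
          rw [if_neg]; omega
    rw [h1, h2, show (j : ℤ) - i + i + 1 = j + 1 by ring]
    ring

lemma abs_trace_sub_sum_walk_le {σ c₀ : ℝ} (hσ : 0 ≤ σ) {v : ℤ → ℝ} (hv : ∀ i, |v i| ≤ c₀)
    (k n : ℕ) : |(boxMatrix σ v n ^ k).trace -
      ∑ i ∈ Finset.range n, walk σ (fun m => v (m + i + 1)) k 0| ≤
      4 * k * (2 + σ * c₀) ^ k := by
  have hR : 0 ≤ (2 + σ * c₀) ^ k := (abs_nonneg _).trans (abs_walk_le hσ hv k 0)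
  rw [trace, Finset.sum_range, ← Finset.sum_sub_distrib]
  simp only [diag_apply]
  set bad : Finset (Fin n) := Finset.univ.filter fun i => ¬ (k ≤ (i : ℕ) ∧ (i : ℕ) + k < n)
  have hbad : bad.card ≤ 2 * k := by
    have himg : bad.image (fun i : Fin n => (i : ℕ)) ⊆ Finset.range k ∪ Finset.Ico (n - k) n := by
      intro x hx
      simp only [bad, Finset.mem_image, Finset.mem_filter, Finset.mem_univ, true_and] at hx
      obtain ⟨i, hi, rfl⟩ := hx
      simp only [Finset.mem_union, Finset.mem_range, Finset.mem_Ico]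
      omega
    rw [← Finset.card_image_of_injective bad Fin.val_injective]
    refine (Finset.card_le_card himg).trans ((Finset.card_union_le _ _).trans ?_)
    rw [Finset.card_range, Nat.card_Ico]
    omega
  calc _ ≤ ∑ i : Fin n, |(boxMatrix σ v n ^ k) i i - walk σ (fun m => v (m + i + 1)) k 0| :=
        Finset.abs_sum_le_sum_abs _ _
    _ ≤ ∑ i : Fin n, (if ¬ (k ≤ (i : ℕ) ∧ (i : ℕ) + k < n) then 2 * (2 + σ * c₀) ^ k else 0) := by
        refine Finset.sum_le_sum fun i _ => ?_
        split_ifs with h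
        · rw [boxMatrix_pow_apply σ v k h.1 h.2 i]
          simp
        · refine (abs_sub _ _).trans ?_
          have h1 := abs_boxMatrix_pow_le hσ hv k i i
          have h2 := abs_walk_le hσ (u := fun m => v (m + i + 1)) (fun m => hv _) k 0
          linarith
    _ = bad.card * (2 * (2 + σ * c₀) ^ k) := by
        rw [← Finset.sum_filter, Finset.sum_const, nsmul_eq_mul]
    _ ≤ (2 * k : ℕ) * (2 * (2 + σ * c₀) ^ k) := by gcongr
    _ = _ := by push_cast; ring

end Moments

/-! ### Existence of the integrated density of states -/

lemma sum_range_mul_eq (X : ℕ → ℝ) (M q : ℕ) :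
    ∑ i ∈ Finset.range (q * M), X i =
      ∑ r ∈ Finset.range M, ∑ j ∈ Finset.range q, X (r + j * M) := by
  induction q with
  | zero => simp
  | succ q ih =>
    rw [Nat.succ_mul, Finset.sum_range_add, ih, ← Finset.sum_add_distrib]
    refine Finset.sum_congr rfl fun r _ => ?_
    rw [Finset.sum_range_succ, add_comm r]

/-- Cesàro averages of a bounded sequence converge if they do along every residue class. -/
lemma tendsto_average_of_residues {X : ℕ → ℝ} {M : ℕ} (hM : 0 < M) {B c : ℝ}
    (hB : ∀ i, |X i| ≤ B)
    (h : ∀ r < M, Tendsto (fun q : ℕ => (∑ j ∈ Finset.range q, X (r + j * M)) / q) atTop (𝓝 c)) :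
    Tendsto (fun n : ℕ => (∑ i ∈ Finset.range n, X i) / n) atTop (𝓝 c) := by
  have hM' : (0 : ℝ) < M := by exact_mod_cast hM
  set A : ℕ → ℝ := fun q => ∑ i ∈ Finset.range (q * M), X i with hA
  have hA1 : Tendsto (fun q : ℕ => A q / q - M * c) atTop (𝓝 0) := by
    have : Tendsto (fun q : ℕ => ∑ r ∈ Finset.range M,
        (∑ j ∈ Finset.range q, X (r + j * M)) / q) atTop (𝓝 (∑ _r ∈ Finset.range M, c)) :=
      tendsto_finsetSum _ fun r hr => h r (Finset.mem_range.mp hr)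
    rw [Finset.sum_const, Finset.card_range, nsmul_eq_mul] at this
    have h2 := this.sub_const (M * c)
    rw [sub_self] at h2
    refine h2.congr fun q => ?_
    rw [hA]
    simp only
    rw [sum_range_mul_eq, Finset.sum_div]
  have hdiv : Tendsto (fun n : ℕ => n / M) atTop atTop := Nat.tendsto_div_const_atTop hM.ne'
  have hlim : Tendsto (fun n : ℕ => |A (n / M) / (n / M : ℕ) - M * c| + M * (B + |c|) / n) atTop
      (𝓝 0) := by
    have h1 := (hA1.comp hdiv).abs
    have h2 := tendsto_const_div_atTop_nhds_zero_nat ((M : ℝ) * (B + |c|))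
    simpa using h1.add h2
  rw [tendsto_iff_norm_sub_tendsto_zero]
  refine squeeze_zero' (Eventually.of_forall fun n => norm_nonneg _) ?_ hlim
  filter_upwards [eventually_ge_atTop M] with n hn
  have hn0 : (0 : ℝ) < n := by exact_mod_cast hM.trans_le hn
  set q := n / M with hq
  have hq0 : (0 : ℝ) < q := by exact_mod_cast Nat.div_pos hn hM
  have hqn : q * M ≤ n := Nat.div_mul_le_self n M
  have hdecomp : n = q * M + n % M := (Nat.div_add_mod' n M).symm
  set s := n % M with hs
  have hsM : s < M := Nat.mod_lt n hM
  have hsplit : ∑ i ∈ Finset.range n, X i = A q + ∑ i ∈ Finset.range s, X (q * M + i) := by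
    conv_lhs => rw [hdecomp]
    rw [Finset.sum_range_add]
  have hrem : |∑ i ∈ Finset.range s, X (q * M + i) - s * c| ≤ M * (B + |c|) := by
    have hB0 : 0 ≤ B := (abs_nonneg _).trans (hB 0)
    have h1 : |∑ i ∈ Finset.range s, X (q * M + i)| ≤ s * B := by
      refine (Finset.abs_sum_le_sum_abs _ _).trans ?_
      refine (Finset.sum_le_sum fun i _ => hB _).trans ?_
      simp
    calc _ ≤ |∑ i ∈ Finset.range s, X (q * M + i)| + |(s : ℝ) * c| := abs_sub _ _
      _ ≤ s * B + s * |c| := by rw [abs_mul, Nat.abs_cast]; gcongr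
      _ = s * (B + |c|) := by ring
      _ ≤ M * (B + |c|) := by gcongr
  have hnr : (n : ℝ) = q * M + s := by exact_mod_cast hdecomp
  have hid : (∑ i ∈ Finset.range n, X i) / n - c =
      (A q / q - M * c) * (q / n) + (∑ i ∈ Finset.range s, X (q * M + i) - s * c) / n := by
    rw [hsplit]
    field_simp
    rw [hnr]
    ring
  rw [Real.norm_eq_abs, hid]
  refine (abs_add_le _ _).trans (add_le_add ?_ ?_)
  · rw [abs_mul]
    refine mul_le_of_le_one_right (abs_nonneg _) ?_
    rw [abs_of_nonneg (by positivity)]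
    refine div_le_one_of_le₀ ?_ hn0.le
    exact_mod_cast Nat.div_le_self n M
  · rw [abs_div, abs_of_pos hn0]
    gcongr

section Weak

/-- A sequence of probability measures on `[-R, R]` whose integrals of polynomials `p` converge
to `c p`. -/
structure MomentConvergence (R : ℝ) (c : Polynomial ℝ → ℝ) (ν : ℕ → Measure ℝ) : Prop where
  prob : ∀ n, IsProbabilityMeasure (ν n)
  compl : ∀ n, ν n (Set.Icc (-R) R)ᶜ = 0
  tendsto : ∀ p : Polynomial ℝ, Tendsto (fun n => ∫ x, p.eval x ∂(ν n)) atTop (𝓝 (c p))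

lemma MomentConvergence.eventually_abs_sub_le {R : ℝ} {c : Polynomial ℝ → ℝ} {ν : ℕ → Measure ℝ}
    (h : MomentConvergence R c ν) (f : ℝ →ᵇ ℝ) {p : Polynomial ℝ} {ε : ℝ} (hε : 0 < ε)
    (hp : ∀ x ∈ Set.Icc (-R) R, |p.eval x - f x| < ε) :
    ∀ᶠ n in atTop, |∫ x, f x ∂(ν n) - c p| ≤ 2 * ε := by
  filter_upwards [Metric.tendsto_nhds.mp (h.tendsto p) ε hε] with n hn
  have := h.prob n
  have hae : ∀ᵐ x ∂(ν n), x ∈ Set.Icc (-R) R := by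
    rw [ae_iff]; exact h.compl n
  have hfi : Integrable (fun x => f x) (ν n) := f.integrable _
  have hpi : Integrable (fun x => p.eval x) (ν n) := by
    refine Integrable.of_bound p.continuous.aestronglyMeasurable (‖f‖ + ε) ?_
    filter_upwards [hae] with x hx
    have h1 := hp x hx
    have h2 := f.norm_coe_le_norm x
    rw [Real.norm_eq_abs] at *
    have := abs_sub_abs_le_abs_sub (p.eval x) (f x)
    linarith
  have hdiff : |∫ x, p.eval x ∂(ν n) - ∫ x, f x ∂(ν n)| ≤ ε := by
    rw [← integral_sub hpi hfi]
    have := norm_integral_le_of_norm_le_const (μ := ν n) (C := ε)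
      (f := fun x => p.eval x - f x) (by filter_upwards [hae] with x hx using (hp x hx).le)
    simpa using this
  rw [Real.dist_eq] at hn
  rw [abs_le] at *
  rw [abs_lt] at hn
  constructor <;> linarith [hn.1, hn.2, hdiff.1, hdiff.2]

/-- Method of moments on a compact interval: the limit measure depends only on the limits of the
moments. -/
lemma MomentConvergence.exists_limit {R : ℝ} {c : Polynomial ℝ → ℝ} {ν : ℕ → Measure ℝ}
    (h : MomentConvergence R c ν) : ∃ μ : Measure ℝ, IsProbabilityMeasure μ ∧
      ∀ ν' : ℕ → Measure ℝ, MomentConvergence R c ν' → ∀ f : ℝ →ᵇ ℝ,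
        Tendsto (fun n => ∫ x, f x ∂(ν' n)) atTop (𝓝 (∫ x, f x ∂μ)) := by
  let ρ : ℕ → ProbabilityMeasure ℝ := fun n => ⟨ν n, h.prob n⟩
  set S : Set (ProbabilityMeasure ℝ) := Set.range ρ with hS
  have htight : IsTightMeasureSet {x | ∃ μ ∈ S, (μ : Measure ℝ) = x} := by
    rw [isTightMeasureSet_iff_exists_isCompact_measure_compl_le]
    intro ε _
    refine ⟨Set.Icc (-R) R, isCompact_Icc, ?_⟩
    rintro _ ⟨_, ⟨n, rfl⟩, rfl⟩
    exact (h.compl n).le.trans (zero_le)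
  have hcomp := isCompact_closure_of_isTightMeasureSet htight
  set U : Ultrafilter ℕ := hyperfilter ℕ with hU
  have hUtop : (U : Filter ℕ) ≤ atTop := Nat.hyperfilter_le_atTop
  obtain ⟨μ, -, hμ⟩ := isCompact_iff_ultrafilter_le_nhds.mp hcomp
    (U.map ρ)
    (le_principal_iff.mpr (Ultrafilter.mem_map.mpr (Filter.univ_mem' fun n => subset_closure ⟨n, rfl⟩)))
  have hμ' : Tendsto ρ U (𝓝 μ) := hμ
  rw [ProbabilityMeasure.tendsto_iff_forall_integral_tendsto] at hμ'
  refine ⟨μ, inferInstance, fun ν' h' f => ?_⟩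
  rw [Metric.tendsto_nhds]
  intro ε hε
  obtain ⟨p, hp⟩ := exists_polynomial_near_of_continuousOn (-R) R f f.continuous.continuousOn
    (ε / 8) (by positivity)
  have h1 : |∫ x, f x ∂(μ : Measure ℝ) - c p| ≤ 2 * (ε / 8) := by
    refine le_of_tendsto ((hμ' f).sub_const (c p)).abs ?_
    exact hUtop (h.eventually_abs_sub_le f (by positivity) hp)
  filter_upwards [h'.eventually_abs_sub_le f (by positivity) hp] with n hn
  rw [Real.dist_eq]
  rw [abs_le] at h1 hn
  rw [abs_lt]
  constructor <;> linarith [h1.1, h1.2, hn.1, hn.2]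

end Weak

section MomentsAlmostSurely
variable {Ω : Type*} [MeasurableSpace Ω] {Pr : Measure Ω} {v : ℤ → Ω → ℝ}

lemma measurable_walk (σ : ℝ) (k : ℕ) (m : ℤ) : Measurable fun u : ℤ → ℝ => walk σ u k m := by
  induction k generalizing m with
  | zero => simp only [walk]; exact measurable_const
  | succ k ih =>
    simp only [walk]
    exact ((ih (m - 1)).add (ih (m + 1))).add
      (((measurable_pi_apply m).const_mul σ).mul (ih m))

/-- The entry `walk σ u k m` depends only on the potential in the window `[-K, K]` once
`k ≤ K + 1`. -/
lemma measurable_walk_iSup {Ω : Type*} (v : ℤ → Ω → ℝ) (σ : ℝ) (i : ℤ) {K k : ℕ} (hk : k ≤ K + 1)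
    (m : ℤ) : Measurable[⨆ l ∈ Set.Icc (i - K) (i + K), MeasurableSpace.comap (v l) inferInstance]
      fun ω => walk σ (fun l => v (l + i) ω) k m := by
  induction k generalizing m with
  | zero => simp only [walk]; exact measurable_const
  | succ k ih =>
    simp only [walk]
    have ih' := ih (by omega)
    refine ((ih' (m - 1)).add (ih' (m + 1))).add ?_
    by_cases hm : |m| ≤ k
    · have hmem : m + i ∈ Set.Icc (i - K) (i + K) := by
        have := abs_le.mp hm
        constructor <;> omega
      have hv : Measurable[⨆ l ∈ Set.Icc (i - K) (i + K),
          MeasurableSpace.comap (v l) inferInstance] (v (m + i)) :=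
        (comap_measurable (v (m + i))).mono
          (le_biSup (fun l => MeasurableSpace.comap (v l) inferInstance) hmem) le_rfl
      exact (hv.const_mul σ).mul (ih' m)
    · have : ∀ ω, walk σ (fun l => v (l + i) ω) k m = 0 :=
        fun ω => walk_eq_zero _ _ _ (not_le.mp hm)
      simp only [this, mul_zero]
      exact measurable_const

lemma ae_forall_abs_le (hv_meas : ∀ i, Measurable (v i)) {P : Measure ℝ}
    (hv_law : ∀ i, Pr.map (v i) = P) {c₀ : ℝ} (hP : ∀ᵐ x ∂P, |x| ≤ c₀) :
    ∀ᵐ ω ∂Pr, ∀ i, |v i ω| ≤ c₀ := by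
  rw [ae_all_iff]
  intro i
  rw [← hv_law i] at hP
  exact ae_of_ae_map (hv_meas i).aemeasurable hP

/-- Strong law of large numbers for the diagonal entries of the powers of the random operator. The
entries of the `k`-th power at sites at distance more than `2k` are independent, so the law for
independent variables applies along each residue class modulo `2k + 1`. -/
lemma ae_tendsto_average_walk [IsProbabilityMeasure Pr] (hv_meas : ∀ i, Measurable (v i))
    (hv_indep : iIndepFun v Pr) {P : Measure ℝ} (hv_law : ∀ i, Pr.map (v i) = P) {c₀ σ : ℝ}
    (hσ : 0 ≤ σ) (hP : ∀ᵐ x ∂P, |x| ≤ c₀) (k : ℕ) :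
    ∃ c : ℝ, ∀ᵐ ω ∂Pr, Tendsto (fun n : ℕ => (∑ i ∈ Finset.range n,
      walk σ (fun m => v (m + i + 1) ω) k 0) / n) atTop (𝓝 c) := by
  have hbdd := ae_forall_abs_le hv_meas hv_law hP
  set X : ℕ → Ω → ℝ := fun i ω => walk σ (fun m => v (m + i + 1) ω) k 0 with hX
  have hXm : ∀ i, Measurable (X i) := fun i =>
    (measurable_walk σ k 0).comp (measurable_pi_lambda _ fun m => hv_meas _)
  have hXint : ∀ i, Integrable (X i) Pr := by
    intro i
    refine Integrable.of_bound (hXm i).aestronglyMeasurable ((2 + σ * c₀) ^ k) ?_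
    filter_upwards [hbdd] with ω hω
    exact abs_walk_le hσ (fun m => hω _) k 0
  have hlaw : ∀ i : ℕ, Pr.map (fun ω (m : ℤ) => v (m + i + 1) ω) =
      Measure.infinitePi fun _ => P := by
    intro i
    have hinj : Function.Injective fun m : ℤ => m + i + 1 := fun a b h => by simpa using h
    have := (hv_indep.precomp hinj).map_fun_eq_infinitePi_map fun m => hv_meas _
    simpa only [hv_law] using this
  have hident : ∀ i j, IdentDistrib (X i) (X j) Pr Pr := by
    intro i j
    have h0 : IdentDistrib (fun ω (m : ℤ) => v (m + i + 1) ω) (fun ω (m : ℤ) => v (m + j + 1) ω)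
        Pr Pr :=
      ⟨(measurable_pi_lambda _ fun m => hv_meas _).aemeasurable,
        (measurable_pi_lambda _ fun m => hv_meas _).aemeasurable, by rw [hlaw i, hlaw j]⟩
    exact h0.comp (measurable_walk σ k 0)
  have hindep : ∀ i j : ℕ, i + (2 * k + 1) ≤ j → IndepFun (X i) (X j) Pr := by
    intro i j hij
    rw [IndepFun_iff_Indep]
    have hdisj : Disjoint (Set.Icc (((i : ℤ) + 1) - k) (((i : ℤ) + 1) + k))
        (Set.Icc (((j : ℤ) + 1) - k) (((j : ℤ) + 1) + k)) := by
      rw [Set.disjoint_left]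
      intro a ha hb
      have := ha.2
      have := hb.1
      omega
    have h := indep_iSup_of_disjoint (fun l => (hv_meas l).comap_le) hv_indep hdisj
    have hm : ∀ i : ℕ, Measurable[⨆ l ∈ Set.Icc (((i : ℤ) + 1) - k) (((i : ℤ) + 1) + k),
        MeasurableSpace.comap (v l) inferInstance] (X i) := by
      intro i
      have := measurable_walk_iSup v σ ((i : ℤ) + 1) (K := k) (k := k) (by omega) 0
      simpa only [← add_assoc] using this
    exact indep_of_indep_of_le_left (indep_of_indep_of_le_right h (hm j).comap_le) (hm i).comap_le
  refine ⟨∫ ω, X 0 ω ∂Pr, ?_⟩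
  have hres : ∀ r : ℕ, ∀ᵐ ω ∂Pr, Tendsto (fun q : ℕ =>
      (∑ j ∈ Finset.range q, X (r + j * (2 * k + 1)) ω) / q) atTop (𝓝 (∫ ω, X 0 ω ∂Pr)) := by
    intro r
    have := strong_law_ae_real (μ := Pr) (fun j => X (r + j * (2 * k + 1))) (hXint _) ?_
      fun j => hident _ _
    · rwa [(hident (r + 0 * (2 * k + 1)) 0).integral_eq] at this
    · intro a b hab
      rcases hab.lt_or_gt with h | h
      · refine hindep _ _ ?_
        nlinarith
      · refine (hindep _ _ ?_).symm
        nlinarith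
  filter_upwards [ae_all_iff.mpr hres, hbdd] with ω hω hb
  exact tendsto_average_of_residues (by omega : 0 < 2 * k + 1)
    (fun i => abs_walk_le hσ (u := fun m => v (m + i + 1) ω) (fun m => hb _) k 0) fun r _ => hω r

/-- The moments of the empirical distributions converge almost surely to constants, up to boundary
terms of order `1 / n`; the limit found at one sample point is then the limit at almost all. The box
of size `0` carries the zero measure, so the sequence starts at size `1`. -/
lemma exists_isIntegratedDensityOfStates [IsProbabilityMeasure Pr] (hv_meas : ∀ i, Measurable (v i))
    (hv_indep : iIndepFun v Pr) {P : Measure ℝ} (hv_law : ∀ i, Pr.map (v i) = P) {c₀ σ : ℝ}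
    (hσ : 0 ≤ σ) (hP : ∀ᵐ x ∂P, |x| ≤ c₀) :
    ∃ μ : Measure ℝ, IsIntegratedDensityOfStates Pr v σ μ := by
  have hbdd := ae_forall_abs_le hv_meas hv_law hP
  choose c hc using fun k => ae_tendsto_average_walk hv_meas hv_indep hv_law hσ hP k
  have hconv : ∀ᵐ ω ∂Pr, MomentConvergence (2 + σ * c₀)
      (fun p => ∑ k ∈ p.support, p.coeff k * c k)
      (fun n => empiricalEigenvalueMeasure σ (fun i => v i ω) (n + 1)) := by
    filter_upwards [ae_all_iff.mpr hc, hbdd] with ω hω hb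
    refine ⟨fun n => isProbabilityMeasure_empiricalEigenvalueMeasure _ _ _,
      fun n => empiricalEigenvalueMeasure_compl_Icc hσ hb _, fun p => ?_⟩
    have hmom : ∀ k, Tendsto (fun n : ℕ => ((boxMatrix σ (fun i => v i ω) n) ^ k).trace / n) atTop
        (𝓝 (c k)) := by
      intro k
      have h0 : Tendsto (fun n : ℕ => ((boxMatrix σ (fun i => v i ω) n) ^ k).trace / n -
          (∑ i ∈ Finset.range n, walk σ (fun m => v (m + i + 1) ω) k 0) / n) atTop (𝓝 0) := by
        refine squeeze_zero_norm (fun n => ?_)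
          (tendsto_const_div_atTop_nhds_zero_nat (4 * k * (2 + σ * c₀) ^ k))
        rw [← sub_div, norm_div, Real.norm_eq_abs, RCLike.norm_natCast]
        exact div_le_div_of_nonneg_right (abs_trace_sub_sum_walk_le hσ hb k n) (Nat.cast_nonneg n)
      simpa using h0.add (hω k)
    have hpoly : ∀ n : ℕ, ∫ x, p.eval x ∂(empiricalEigenvalueMeasure σ (fun i => v i ω) n) =
        ∑ k ∈ p.support, p.coeff k * (((boxMatrix σ (fun i => v i ω) n) ^ k).trace / n) := by
      intro n
      rw [integral_empiricalEigenvalueMeasure]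
      simp only [Polynomial.eval_eq_sum, Polynomial.sum_def]
      rw [Finset.sum_comm, Finset.sum_div]
      refine Finset.sum_congr rfl fun k _ => ?_
      rw [← Finset.mul_sum, sum_eigenvalues_pow_eq_trace, mul_div_assoc]
    refine (tendsto_add_atTop_iff_nat (f := fun n =>
      ∫ x, p.eval x ∂(empiricalEigenvalueMeasure σ (fun i => v i ω) n)) 1).mpr ?_
    simp only [hpoly]
    exact tendsto_finsetSum _ fun k _ => (hmom k).const_mul _
  obtain ⟨ω₀, hω₀⟩ := hconv.exists
  obtain ⟨μ, hμ, hlim⟩ := hω₀.exists_limit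
  refine ⟨μ, hμ, ?_⟩
  filter_upwards [hconv] with ω hω f
  exact (tendsto_add_atTop_iff_nat 1).mp (hlim _ hω f)

end MomentsAlmostSurely

/-! ### Generic energies -/

open Polynomial in
/-- The solution as a polynomial in the energy. -/
noncomputable def solPoly (σ : ℝ) (V : ℕ → ℝ) : ℕ → ℝ[X]
  | 0 => 0
  | 1 => 1
  | (j + 2) => (X - C (σ * V j)) * solPoly σ V (j + 1) - solPoly σ V j

lemma eval_solPoly (σ E : ℝ) (V : ℕ → ℝ) (j : ℕ) :
    (solPoly σ V j).eval E = sol σ E V j ∧ (solPoly σ V (j + 1)).eval E = sol σ E V (j + 1) := by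
  induction j with
  | zero => simp [solPoly]
  | succ j ih =>
    refine ⟨ih.2, ?_⟩
    rw [solPoly, sol_add_two, ← ih.1, ← ih.2]
    simp

lemma monic_solPoly (σ : ℝ) (V : ℕ → ℝ) (j : ℕ) :
    (solPoly σ V (j + 1)).Monic ∧ (solPoly σ V j).degree < (solPoly σ V (j + 1)).degree := by
  induction j with
  | zero => simp [solPoly]
  | succ j ih =>
    have hmonic := (Polynomial.monic_X_sub_C (σ * V j)).mul ih.1
    have hdeg : (solPoly σ V (j + 1)).degree <
        ((Polynomial.X - Polynomial.C (σ * V j)) * solPoly σ V (j + 1)).degree := by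
      rw [Polynomial.degree_mul, Polynomial.degree_X_sub_C,
        Polynomial.degree_eq_natDegree ih.1.ne_zero]
      exact_mod_cast (by omega : (solPoly σ V (j + 1)).natDegree <
        1 + (solPoly σ V (j + 1)).natDegree)
    rw [show solPoly σ V (j + 1 + 1) = (Polynomial.X - Polynomial.C (σ * V j)) *
      solPoly σ V (j + 1) - solPoly σ V j from rfl]
    refine ⟨hmonic.sub_of_left (ih.2.trans hdeg), ?_⟩
    rwa [Polynomial.degree_sub_eq_left_of_degree_lt (ih.2.trans hdeg)]

section Generic
variable {Ω : Type*} [MeasurableSpace Ω] {Pr : Measure Ω} {W : ℕ → Ω → ℝ}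

lemma measurable_sol_prod (hW : ∀ i, Measurable (W i)) (σ : ℝ) (j : ℕ) :
    Measurable (fun x : ℝ × Ω => sol σ x.1 (fun i => W i x.2) j) ∧
      Measurable (fun x : ℝ × Ω => sol σ x.1 (fun i => W i x.2) (j + 1)) := by
  induction j with
  | zero => simp only [sol_zero, zero_add, sol_one]; exact ⟨measurable_const, measurable_const⟩
  | succ j ih =>
    refine ⟨ih.2, ?_⟩
    simp only [sol_add_two]
    exact ((measurable_fst.sub (((hW j).comp measurable_snd).const_mul σ)).mul ih.2).sub ih.1

/-- At almost every energy, the solution almost surely has no zero. -/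
lemma ae_ae_sol_ne_zero [SFinite Pr] (hW : ∀ i, Measurable (W i)) (σ : ℝ) :
    ∀ᵐ E : ℝ, ∀ᵐ ω ∂Pr, ∀ j, sol σ E (fun i => W i ω) (j + 1) ≠ 0 := by
  have hmeas : MeasurableSet {x : ℝ × Ω | ∀ j, sol σ x.1 (fun i => W i x.2) (j + 1) ≠ 0} := by
    rw [Set.ofPred_forall]
    exact MeasurableSet.iInter fun j =>
      ((measurable_sol_prod hW σ j).2 (measurableSet_singleton 0)).compl
  rw [Measure.ae_ae_comm hmeas]
  refine ae_of_all _ fun ω => ae_all_iff.mpr fun j => ?_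
  rw [ae_iff]
  refine (Set.Finite.subset ((solPoly σ (fun i => W i ω) (j + 1)).roots.toFinset.finite_toSet)
    fun E hE => ?_).measure_zero _
  have h0 : sol σ E (fun i => W i ω) (j + 1) = 0 := by simpa using hE
  rw [← (eval_solPoly σ E _ j).2] at h0
  simpa [Polynomial.mem_roots', (monic_solPoly σ (fun i => W i ω) j).1.ne_zero] using h0

end Generic

/-! ### The bound on the integrated density of states -/

lemma norm_one_sub_conj_sq {z : ℂ} (hz : ‖z‖ = 1) : ‖1 - (starRingEnd ℂ) z ^ 2‖ = 2 * |z.im| := by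
  have h : 1 - (starRingEnd ℂ) z ^ 2 = (starRingEnd ℂ) z * (z - (starRingEnd ℂ) z) := by
    have : (starRingEnd ℂ) z * z = 1 := by
      rw [mul_comm, Complex.mul_conj, Complex.normSq_eq_norm_sq, hz]; simp
    rw [mul_sub, this]; ring
  rw [h, norm_mul, RCLike.norm_conj, hz, one_mul, Complex.sub_conj, norm_mul, Complex.norm_I,
    mul_one, Complex.norm_real, Real.norm_eq_abs, abs_mul, abs_two]

/-- The parameters of the pair dynamics at an energy `a` away from `0` and `±2`. -/
lemma exists_stepParams {c₀ σ γ a d : ℝ} (hc₀ : 1 ≤ c₀) (hγ : 0 < γ) (hσ : 0 < σ)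
    (hAγ : 460 * (c₀ ^ 3 * σ) < γ) (ha : γ < |a|) (ha' : |a| < 2 - γ) (hd0 : 0 < d)
    (hd : d < σ ^ 3) :
    ∃ ζ : ℂ, 2 * ζ.re = a ∧ 0 < ζ.im ∧ ζ.im ≤ 1 ∧ 3 / 4 * γ ≤ ζ.im ^ 2 * |a| ∧
      ∀ r, 0 < r → r ≤ 1 / 2 →
        StepParams r (σ / ζ.im) (ζ.im * |a|) (σ / ζ.im * c₀) (d / ζ.im) ζ := by
  have hγ1 : γ < 1 := by linarith
  have hc3 : c₀ ≤ c₀ ^ 3 := le_self_pow₀ hc₀ (by norm_num)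
  have hσc : σ * c₀ ≤ c₀ ^ 3 * σ := by rw [mul_comm]; gcongr
  have hσσ : σ ≤ σ * c₀ := le_mul_of_one_le_right hσ.le hc₀
  have hσ1 : 460 * σ < 1 := by linarith
  have ha0 : 0 < |a| := hγ.trans ha
  have hS2 : 0 < 1 - |a| ^ 2 / 4 := by nlinarith
  obtain ⟨S, hS, hSsq⟩ : ∃ S : ℝ, 0 < S ∧ S ^ 2 = 1 - |a| ^ 2 / 4 :=
    ⟨Real.sqrt (1 - |a| ^ 2 / 4), Real.sqrt_pos.mpr hS2, Real.sq_sqrt hS2.le⟩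
  have hS1 : S ≤ 1 := (sq_le_one_iff₀ hS.le).mp (by rw [hSsq]; linarith [sq_nonneg |a|])
  have hSa : 3 / 4 * γ ≤ S ^ 2 * |a| := by
    rw [hSsq]
    rcases le_total |a| 1 with h | h
    · nlinarith
    · have h1 : γ ≤ 2 - |a| := by linarith
      have h2 : 3 ≤ |a| * (2 + |a|) := by nlinarith
      have h3 := mul_le_mul h1 h2 (by norm_num) (by linarith)
      linarith
  have hnorm : ‖(⟨a / 2, S⟩ : ℂ)‖ = 1 := by
    rw [← sq_eq_sq₀ (norm_nonneg _) zero_le_one, ← Complex.normSq_eq_norm_sq, Complex.normSq_mk]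
    rw [sq_abs] at hSsq
    linarith
  refine ⟨⟨a / 2, S⟩, by ring, hS, hS1, hSa, fun r hr0 hr1 => ?_⟩
  have hg0 : 0 < S * |a| := by positivity
  have him : (⟨a / 2, S⟩ : ℂ).im = S := rfl
  refine ⟨hr0, hr1, by positivity, ?_, hg0, ?_, ?_, by positivity, ?_, hnorm, ?_, ?_⟩
  · exact le_mul_of_one_le_right (by positivity) hc₀
  · refine (sq_le_one_iff₀ hg0.le).mp ?_
    rw [mul_pow, hSsq]
    linarith [sq_nonneg (|a| ^ 2 / 2 - 1)]
  · rw [div_mul_eq_mul_div, div_le_div_iff₀ hS (by norm_num)]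
    linarith
  · rw [div_mul_eq_mul_div, div_div, div_le_div_iff₀ hS (by positivity)]
    have h1 : σ ^ 3 ≤ σ / 100 := by
      have : σ ^ 2 ≤ 1 / 100 := by nlinarith
      calc σ ^ 3 = σ * σ ^ 2 := by ring
        _ ≤ σ * (1 / 100) := by gcongr
        _ = σ / 100 := by ring
    have h2 : d * 100 ≤ σ * c₀ := by linarith
    calc d * (S * 100) = d * 100 * S := by ring
      _ ≤ σ * c₀ * S := by gcongr
  · rw [norm_one_sub_conj_sq hnorm, him, abs_of_pos hS]
    nlinarith
  · have hnorm2 : ‖(⟨a / 2, S⟩ : ℂ) ^ 2‖ = 1 := by rw [norm_pow, hnorm, one_pow]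
    have h4 := norm_one_sub_conj_sq hnorm2
    rw [map_pow, ← pow_mul] at h4
    rw [h4, pow_two (⟨a / 2, S⟩ : ℂ), Complex.mul_im,
      show a / 2 * S + S * (a / 2) = S * a by ring, abs_mul, abs_of_pos hS]

section Bound
variable {Ω : Type*} [MeasurableSpace Ω] {Pr : Measure Ω} {v : ℤ → Ω → ℝ}

/-- The mass that the limit gives to an interval between two generic energies is bounded by the
expected number of sites at which the two solution vectors are almost orthogonal. -/
lemma integral_le_of_lyapunov_bound [IsProbabilityMeasure Pr] (hv_meas : ∀ i, Measurable (v i))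
    {P : Measure ℝ} (hv_law : ∀ i, Pr.map (v i) = P) {c₀ σ : ℝ} (hσ : 0 < σ)
    (hP : ∀ᵐ x ∂P, |x| ≤ c₀) {μ : Measure ℝ} (hμ : IsIntegratedDensityOfStates Pr v σ μ)
    {r g d K : ℝ} {ζ : ℂ} (hS : 0 < ζ.im)
    (H : StepParams r (σ / ζ.im) g (σ / ζ.im * c₀) (d / ζ.im) ζ) (hd0 : 0 < d)
    (hd : d < 2 * ζ.im)
    (hp : ∀ᵐ ω ∂Pr, ∀ j, sol σ (2 * ζ.re) (fun i => v (i + 1) ω) (j + 1) ≠ 0)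
    (hq : ∀ᵐ ω ∂Pr, ∀ j, sol σ (2 * ζ.re + d) (fun i => v (i + 1) ω) (j + 1) ≠ 0)
    (hK : ∀ j, ∫ ω, lyapunov r (σ / ζ.im) ζ (solVec ζ σ (2 * ζ.re) (fun i => v (i + 1) ω) j)
      (solVec ζ σ (2 * ζ.re + d) (fun i => v (i + 1) ω) j) ∂Pr ≤ K)
    (φ : ℝ →ᵇ ℝ) (hφ : ∀ x, φ x ≤ (Set.Ioo (2 * ζ.re) (2 * ζ.re + d)).indicator 1 x) :
    ∫ x, φ x ∂μ ≤ 1.1 * K := by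
  have hζ : ζ.re ^ 2 + ζ.im ^ 2 = 1 := by
    have := H.norm_ζ
    rw [← sq_eq_sq₀ (norm_nonneg _) zero_le_one, ← Complex.normSq_eq_norm_sq,
      Complex.normSq_apply] at this
    linarith
  have hW : ∀ i : ℕ, Measurable (v (i + 1)) := fun i => hv_meas _
  set F : ℕ → Ω → ℝ := fun j ω => lyapunov r (σ / ζ.im) ζ
    (solVec ζ σ (2 * ζ.re) (fun i => v (i + 1) ω) j)
    (solVec ζ σ (2 * ζ.re + d) (fun i => v (i + 1) ω) j) with hF
  have hF0 : ∀ j ω, 0 ≤ F j ω := fun j ω => lyapunov_nonneg _ _ _ _ _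
  have hFm : ∀ j, Measurable (F j) := fun j =>
    Measurable.lyapunov r _ ζ (measurable_solVec (W := fun i : ℕ => v (i + 1)) hW ζ σ _ j)
      (measurable_solVec (W := fun i : ℕ => v (i + 1)) hW ζ σ _ j)
  have hFi : ∀ j, Integrable (F j) Pr := by
    intro j
    refine Integrable.of_bound (hFm j).aestronglyMeasurable 1.01 (ae_of_all _ fun ω => ?_)
    rw [Real.norm_eq_abs, abs_of_nonneg (hF0 j ω)]
    exact H.lyapunov_le _ _
  have hK0 : 0 ≤ K := (integral_nonneg (hF0 0)).trans (hK 0)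
  set X : ℕ → Ω → ℝ := fun n ω => (2 + ∑ j ∈ Finset.range n, 1.1 * F j ω) / n with hX
  have hXm : ∀ n, Measurable (X n) := fun n =>
    ((Finset.measurable_fun_sum _ fun j _ => (hFm j).const_mul _).const_add _).div_const _
  have hX0 : ∀ n ω, 0 ≤ X n ω := fun n ω =>
    div_nonneg (add_nonneg zero_le_two (Finset.sum_nonneg fun j _ =>
      mul_nonneg (by norm_num) (hF0 j ω))) (Nat.cast_nonneg n)
  have hXi : ∀ n, Integrable (X n) Pr := fun n =>
    ((integrable_const _).add (integrable_finsetSum _ fun j _ => (hFi j).const_mul _)).div_const _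
  have hXint : ∀ n : ℕ, ∫ ω, X n ω ∂Pr ≤ 2 / n + 1.1 * K := by
    intro n
    simp only [hX]
    rw [integral_div, integral_add (integrable_const _)
      (integrable_finsetSum _ fun j _ => (hFi j).const_mul _),
      integral_finsetSum _ fun j _ => (hFi j).const_mul _]
    simp only [integral_const, probReal_univ, one_smul, integral_const_mul]
    rw [add_div]
    gcongr
    refine div_le_of_le_mul₀ (Nat.cast_nonneg n) (by positivity) ?_
    calc _ ≤ ∑ _j ∈ Finset.range n, 1.1 * K :=
          Finset.sum_le_sum fun j _ => mul_le_mul_of_nonneg_left (hK j) (by norm_num)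
      _ = 1.1 * K * n := by rw [Finset.sum_const, Finset.card_range, nsmul_eq_mul]; ring
  have hcount : ∀ᵐ ω ∂Pr, ∀ n : ℕ,
      ∫ x, φ x ∂(empiricalEigenvalueMeasure σ (fun i => v i ω) n) ≤ X n ω := by
    filter_upwards [hp, hq, ae_forall_abs_le hv_meas hv_law hP] with ω hpω hqω hb n
    rw [integral_empiricalEigenvalueMeasure, hX]
    refine div_le_div_of_nonneg_right ?_ (Nat.cast_nonneg n)
    calc _ ≤ ∑ i, (Set.Ioo (2 * ζ.re) (2 * ζ.re + d)).indicator 1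
          ((boxMatrix_isHermitian σ (fun i => v i ω) n).eigenvalues i) :=
          Finset.sum_le_sum fun i _ => hφ _
      _ = ((Finset.univ.filter fun i => (boxMatrix_isHermitian σ (fun i => v i ω) n).eigenvalues i ∈
            Set.Ioo (2 * ζ.re) (2 * ζ.re + d)).card : ℝ) := by
          rw [← Finset.sum_boole]
          refine Finset.sum_congr rfl fun i _ => ?_
          rw [Set.indicator_apply, Pi.one_apply]
      _ ≤ _ := card_eigenvalues_Ioo_le σ (by linarith) (fun i => v i ω) hpω hqω
      _ ≤ _ := by
          refine sum_ite_sub_ite_le hd0 hd hpω hqω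
            (fun j => mul_nonneg (by norm_num) (hF0 j ω)) (fun j hj => ?_) n
          by_contra hcon
          rw [not_lt] at hcon
          refine hj.not_ge ?_
          have e0 := solVec_succ hζ hS.ne' σ 0 (fun i => v (i + 1) ω) j
          rw [add_zero, zero_div, sub_zero] at e0
          rw [e0, solVec_succ hζ hS.ne' σ d (fun i => v (i + 1) ω) j] at hcon
          have n0 := solVec_ne_zero hζ hS.ne' σ 0 (fun i => v (i + 1) ω) j
          rw [add_zero] at n0
          refine H.one_le_lyapunov_of_inner_nonpos n0
            (solVec_ne_zero hζ hS.ne' σ d (fun i => v (i + 1) ω) j) ?_ hcon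
          rw [abs_mul, abs_of_pos (div_pos hσ hS)]
          exact mul_le_mul_of_nonneg_left (hb _) (div_pos hσ hS).le
  -- The lemma of Fatou passes from the bound in expectation at finite `n` to the nonrandom limit.
  have hlim : ENNReal.ofReal (∫ x, φ x ∂μ) ≤ ENNReal.ofReal (1.1 * K) := by
    calc ENNReal.ofReal (∫ x, φ x ∂μ) = ∫⁻ _ω, ENNReal.ofReal (∫ x, φ x ∂μ) ∂Pr := by simp
      _ ≤ ∫⁻ ω, liminf (fun n => ENNReal.ofReal (X n ω)) atTop ∂Pr := by
          refine lintegral_mono_ae ?_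
          filter_upwards [hμ.2, hcount] with ω hω hc
          rw [← ((ENNReal.continuous_ofReal.tendsto _).comp (hω φ)).liminf_eq]
          exact liminf_le_liminf (Eventually.of_forall fun n => ENNReal.ofReal_le_ofReal (hc n))
      _ ≤ liminf (fun n => ∫⁻ ω, ENNReal.ofReal (X n ω) ∂Pr) atTop :=
          lintegral_liminf_le fun n => (hXm n).ennreal_ofReal
      _ ≤ liminf (fun n : ℕ => ENNReal.ofReal (2 / n + 1.1 * K)) atTop := by
          refine liminf_le_liminf (Eventually.of_forall fun n => ?_)
          rw [← ofReal_integral_eq_lintegral_ofReal (hXi n) (ae_of_all _ (hX0 n))]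
          exact ENNReal.ofReal_le_ofReal (hXint n)
      _ = ENNReal.ofReal (1.1 * K) := by
          refine Tendsto.liminf_eq ((ENNReal.continuous_ofReal.tendsto _).comp ?_)
          have := (tendsto_const_div_atTop_nhds_zero_nat (2 : ℝ)).add_const (1.1 * K)
          rwa [zero_add] at this
  exact (ENNReal.ofReal_le_ofReal_iff (by positivity)).mp hlim

/-- With `A = c₀³σ/γ` and the power `2r = 1 - 230A`, the average contraction dominates the third-order
error terms and leaves a surplus `7 (σ/S)² A`. Here `S = sin k` and `x = 2 |cos k|`. -/
lemma gain_le {c₀ σ γ S x : ℝ} (hc₀ : 1 ≤ c₀) (hγ : 0 < γ) (hσ : 0 < σ) (hS : 0 < S) (hx : 0 < x)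
    (hSx : 3 / 4 * γ ≤ S ^ 2 * x) (hA0 : 0 ≤ c₀ ^ 3 * σ / γ) (hA1 : c₀ ^ 3 * σ / γ ≤ 1 / 460) :
    7 * ((σ / S) ^ 2 * (c₀ ^ 3 * σ / γ)) + 16 * ((σ / S * c₀) ^ 3 / (S * x)) ≤
      (σ / S) ^ 2 * ((1 - 230 * (c₀ ^ 3 * σ / γ)) / 4 * (230 * (c₀ ^ 3 * σ / γ))) := by
  have e : (σ / S * c₀) ^ 3 / (S * x) = (σ / S) ^ 2 * (σ * c₀ ^ 3 / (S ^ 2 * x)) := by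
    field_simp
  have h1 : σ * c₀ ^ 3 / (S ^ 2 * x) ≤ 4 / 3 * (c₀ ^ 3 * σ / γ) := by
    calc _ ≤ σ * c₀ ^ 3 / (3 / 4 * γ) := by gcongr
      _ = _ := by field_simp
  rw [e]
  set A := c₀ ^ 3 * σ / γ
  have h2 : 7 * A + 16 * (4 / 3 * A) ≤ (1 - 230 * A) / 4 * (230 * A) := by nlinarith
  calc _ ≤ 7 * ((σ / S) ^ 2 * A) + 16 * ((σ / S) ^ 2 * (4 / 3 * A)) := by gcongr
    _ = (σ / S) ^ 2 * (7 * A + 16 * (4 / 3 * A)) := by ring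
    _ ≤ _ := by gcongr

/-- The stationary value of the Lyapunov function in terms of the energy difference `d`. -/
lemma stationary_bound_le {c₀ σ γ S d r : ℝ} (hd0 : 0 < d) (hS : 0 < S) (hS1 : S ≤ 1)
    (hh1 : d / S ≤ 1) (hσ : 0 < σ) (hγ : 0 < γ) (hγ1 : γ ≤ 1) (hc : 1 ≤ c₀ ^ 3) (hr0 : 0 < r)
    (hr1 : r ≤ 1 / 2) :
    1.1 * ((1.01 * (d / S) + 1.1 * (d / S) ^ (2 * r)) /
      (7 * ((σ / S) ^ 2 * (c₀ ^ 3 * σ / γ)))) ≤ d ^ (2 * r) / (2 * σ ^ 3) := by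
  have hh0 : 0 < d / S := by positivity
  have hc0 : c₀ ≠ 0 := by rintro rfl; norm_num at hc
  have hle1 : d / S ≤ (d / S) ^ (2 * r) := by
    calc d / S = (d / S) ^ (1 : ℝ) := (Real.rpow_one _).symm
      _ ≤ _ := Real.rpow_le_rpow_of_exponent_ge hh0 hh1 (by linarith)
  have hle2 : (d / S) ^ (2 * r) ≤ d ^ (2 * r) / S := by
    rw [Real.div_rpow hd0.le hS.le]
    have : S ≤ S ^ (2 * r) := by
      calc S = S ^ (1 : ℝ) := (Real.rpow_one _).symm
        _ ≤ _ := Real.rpow_le_rpow_of_exponent_ge hS hS1 (by linarith)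
    gcongr
  have hdr : 0 < d ^ (2 * r) := by positivity
  have hsum : 1.01 * (d / S) + 1.1 * (d / S) ^ (2 * r) ≤ 2.11 * (d ^ (2 * r) / S) := by linarith
  have hden : 0 ≤ 7 * ((σ / S) ^ 2 * (c₀ ^ 3 * σ / γ)) := by positivity
  have hq : 0 < d ^ (2 * r) / σ ^ 3 := by positivity
  calc _ ≤ 1.1 * (2.11 * (d ^ (2 * r) / S) / (7 * ((σ / S) ^ 2 * (c₀ ^ 3 * σ / γ)))) := by gcongr
    _ = 2.321 / 7 * (d ^ (2 * r) / σ ^ 3) * (S * γ / c₀ ^ 3) := by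
        field_simp
        norm_num
    _ ≤ 2.321 / 7 * (d ^ (2 * r) / σ ^ 3) * 1 := by
        gcongr
        refine div_le_one_of_le₀ ?_ (by linarith)
        calc S * γ ≤ 1 * 1 := by gcongr
          _ ≤ c₀ ^ 3 := by linarith
    _ ≤ 1 / 2 * (d ^ (2 * r) / σ ^ 3) := by linarith
    _ = _ := by field_simp

/-- The bound for an interval between two generic energies. -/
lemma integral_le_rpow [IsProbabilityMeasure Pr] (hv_meas : ∀ i, Measurable (v i))
    (hv_indep : iIndepFun v Pr) {P : Measure ℝ} [IsProbabilityMeasure P]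
    (hv_law : ∀ i, Pr.map (v i) = P) {c₀ σ γ : ℝ} (hmean : ∫ x, x ∂P = 0)
    (hvar : variance (fun x : ℝ => x) P = 1) (hP : ∀ᵐ x ∂P, |x| ≤ c₀) (hγ : 0 < γ) (hσ : 0 < σ)
    (hA : 460 * c₀ ^ 3 * σ / γ < 1) {μ : Measure ℝ} (hμ : IsIntegratedDensityOfStates Pr v σ μ)
    {a d : ℝ} (ha : γ < |a|) (ha' : |a| < 2 - γ) (hd0 : 0 < d) (hd : d < σ ^ 3)
    (hp : ∀ᵐ ω ∂Pr, ∀ j, sol σ a (fun i => v (i + 1) ω) (j + 1) ≠ 0)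
    (hq : ∀ᵐ ω ∂Pr, ∀ j, sol σ (a + d) (fun i => v (i + 1) ω) (j + 1) ≠ 0)
    (φ : ℝ →ᵇ ℝ) (hφ : ∀ x, φ x ≤ (Set.Ioo a (a + d)).indicator 1 x) :
    ∫ x, φ x ∂μ ≤ d ^ (1 - 230 * c₀ ^ 3 * σ / γ) / (2 * σ ^ 3) := by
  have hc₀ := one_le_of_variance_eq_one hmean hvar hP
  have hγ1 : γ < 1 := by linarith
  have hc3 : c₀ ≤ c₀ ^ 3 := le_self_pow₀ hc₀ (by norm_num)
  have hc31 : 1 ≤ c₀ ^ 3 := hc₀.trans hc3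
  have hAγ : 460 * (c₀ ^ 3 * σ) < γ := by
    rw [div_lt_one hγ] at hA; linarith
  have hσ1 : 460 * σ < 1 := by nlinarith
  set A := c₀ ^ 3 * σ / γ with hAdef
  have hA0 : 0 < A := by positivity
  have hA1 : A < 1 / 460 := by rw [hAdef, div_lt_iff₀ hγ]; linarith
  set r := (1 - 230 * A) / 2 with hr
  have h2r : 2 * r = 1 - 230 * c₀ ^ 3 * σ / γ := by rw [hr, hAdef]; ring
  have hr0 : 0 < r := by rw [hr]; linarith
  have hr1 : r ≤ 1 / 2 := by rw [hr]; linarith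
  obtain ⟨ζ, hre, hS, hS1, hSa, Hall⟩ := exists_stepParams hc₀ hγ hσ hAγ ha ha' hd0 hd
  have H := Hall r hr0 hr1
  clear Hall
  have ha0 : 0 < |a| := hγ.trans ha
  set S := ζ.im with him
  set τ := σ / S with hτ
  set g := S * |a| with hg
  have hτ0 : 0 < τ := by positivity
  set ε := 7 * (τ ^ 2 * A) with hε
  have hε0 : 0 < ε := by positivity
  have hgain : ε + 16 * ((τ * c₀) ^ 3 / g) ≤ τ ^ 2 * (r / 2 * (1 - 2 * r)) := by
    have h1 := gain_le hc₀ hγ hσ hS ha0 hSa hA0.le hA1.le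
    have e : r / 2 * (1 - 2 * r) = (1 - 230 * A) / 4 * (230 * A) := by rw [hr]; ring
    rw [e]
    exact h1
  have hτ1 : τ ≤ 1 := by
    have := H.τ_le
    have := H.T_le'
    linarith
  have hε1 : ε ≤ 1 := by
    rw [hε]
    have : τ ^ 2 ≤ 1 := pow_le_one₀ hτ0.le hτ1
    nlinarith
  have hind : iIndepFun (fun i : ℕ => v (i + 1)) Pr :=
    hv_indep.precomp (g := fun i : ℕ => (i : ℤ) + 1) fun x y h => by simpa using h
  have hK := fun j => integral_lyapunov_solVec_le (W := fun i : ℕ => v (i + 1))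
    (fun i => hv_meas _) hind (fun i => hv_law _) hS H hmean hvar hP hε0
    hgain hε1 j
  have hdS : d < 2 * S := by
    have h1 := H.h_le
    have h2 := H.T_le'
    rw [div_le_iff₀ hS] at h1
    nlinarith
  rw [← hre] at hp hq
  have hmain := integral_le_of_lyapunov_bound hv_meas hv_law hσ hP hμ hS H hd0
    hdS hp hq hK φ (by rw [hre]; exact hφ)
  refine hmain.trans ?_
  rw [← h2r]
  have hh1 : d / S ≤ 1 := by
    have h1 := H.h_le
    have h2 := H.T_le'
    linarith
  exact stationary_bound_le hd0 hS hS1 hh1 hσ hγ hγ1.le hc31 hr0 hr1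

end Bound

/-- Short intervals: the interval is enlarged to one of length at most `2 l` whose end points are
generic, in the sense that the solutions there have no zeros. -/
lemma measureReal_Icc_le {Ω : Type*} [MeasurableSpace Ω] {Pr : Measure Ω} [IsProbabilityMeasure Pr]
    {v : ℤ → Ω → ℝ} (hv_meas : ∀ i, Measurable (v i))
    (hv_indep : iIndepFun v Pr) {P : Measure ℝ} [IsProbabilityMeasure P]
    (hv_law : ∀ i, Pr.map (v i) = P) {c₀ σ γ : ℝ} (hmean : ∫ x, x ∂P = 0)
    (hvar : variance (fun x : ℝ => x) P = 1) (hP : ∀ᵐ x ∂P, |x| ≤ c₀) (hγ : 0 < γ) (hσ : 0 < σ)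
    (hA : 460 * c₀ ^ 3 * σ / γ < 1) {μ : Measure ℝ} (hμ : IsIntegratedDensityOfStates Pr v σ μ)
    {l₀ l : ℝ} (hl₀ : l₀ ∈ Set.Ioo (-2 + γ) (-γ) ∪ Set.Ioo γ (2 - γ)) (hl : 0 < l)
    (hlσ : l < σ ^ 3 / 2) :
    μ.real (Set.Icc l₀ (l₀ + l)) ≤ (2 * l) ^ (1 - 230 * c₀ ^ 3 * σ / γ) / (2 * σ ^ 3) := by
  have := hμ.1
  obtain ⟨x, hx, hxa⟩ : ∃ x < l₀, ∀ a, x < a → a < l₀ → γ < |a| ∧ |a| < 2 - γ := by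
    rcases hl₀ with h | h
    · refine ⟨-2 + γ, h.1, fun a h1 h2 => ?_⟩
      rw [abs_of_neg (by linarith [h.2])]
      constructor <;> linarith [h.2]
    · refine ⟨γ, h.1, fun a h1 h2 => ?_⟩
      rw [abs_of_pos (by linarith)]
      constructor <;> linarith [h.2]
  have hdense : Dense {E : ℝ | ∀ᵐ ω ∂Pr, ∀ j, sol σ E (fun i => v (i + 1) ω) (j + 1) ≠ 0} :=
    Measure.dense_of_ae (ae_ae_sol_ne_zero (W := fun i : ℕ => v (i + 1)) (fun i => hv_meas _) σ)
  obtain ⟨a, hap, ha1, ha2⟩ := hdense.exists_between (max_lt hx (by linarith : l₀ - l / 2 < l₀))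
  obtain ⟨b, hbp, hb1, hb2⟩ := hdense.exists_between (by linarith : l₀ + l < l₀ + l + l / 2)
  rw [max_lt_iff] at ha1
  obtain ⟨ha3, ha4⟩ := hxa a ha1.1 ha2
  obtain ⟨d, rfl⟩ : ∃ d, b = a + d := ⟨b - a, by ring⟩
  have hd0 : 0 < d := by linarith
  have hd2 : d ≤ 2 * l := by linarith
  obtain ⟨f, hf0, hf1, hf01⟩ := exists_continuous_zero_one_of_isClosed
    (isOpen_Ioo (a := a) (b := a + d)).isClosed_compl (isClosed_Icc (a := l₀) (b := l₀ + l))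
    (by
      rw [Set.disjoint_compl_left_iff_subset]
      exact fun y hy => ⟨by linarith [hy.1], by linarith [hy.2]⟩)
  set φ : ℝ →ᵇ ℝ := BoundedContinuousFunction.ofNormedAddCommGroup f f.continuous 1
    (fun y => by rw [Real.norm_eq_abs, abs_of_nonneg (hf01 y).1]; exact (hf01 y).2) with hφ
  have hφf : ∀ y, φ y = f y := fun _ => rfl
  have hle : ∀ y, φ y ≤ (Set.Ioo a (a + d)).indicator 1 y := by
    intro y
    rw [hφf]
    by_cases hy : y ∈ Set.Ioo a (a + d)
    · rw [Set.indicator_of_mem hy]; exact (hf01 y).2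
    · rw [Set.indicator_of_notMem hy]; exact (hf0 hy).le
  have hmain := integral_le_rpow hv_meas hv_indep hv_law hmean hvar hP hγ hσ hA hμ ha3 ha4 hd0
    (by linarith) hap hbp φ hle
  have hexp : 0 ≤ 1 - 230 * c₀ ^ 3 * σ / γ := by
    have hc₀ := one_le_of_variance_eq_one hmean hvar hP
    have h0 : 0 ≤ c₀ ^ 3 * σ / γ := by positivity
    have e1 : 460 * c₀ ^ 3 * σ / γ = 460 * (c₀ ^ 3 * σ / γ) := by ring
    have e2 : 230 * c₀ ^ 3 * σ / γ = 230 * (c₀ ^ 3 * σ / γ) := by ring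
    rw [e1] at hA
    rw [e2]
    linarith
  calc μ.real (Set.Icc l₀ (l₀ + l))
      = ∫ y, (Set.Icc l₀ (l₀ + l)).indicator 1 y ∂μ := by
        rw [integral_indicator_one measurableSet_Icc]
    _ ≤ ∫ y, φ y ∂μ := by
        refine integral_mono ((integrable_const (1 : ℝ)).indicator measurableSet_Icc)
          (φ.integrable μ) fun y => ?_
        by_cases hy : y ∈ Set.Icc l₀ (l₀ + l)
        · rw [Set.indicator_of_mem hy, hφf, hf1 hy]
        · rw [Set.indicator_of_notMem hy, hφf]; exact (hf01 y).1
    _ ≤ d ^ (1 - 230 * c₀ ^ 3 * σ / γ) / (2 * σ ^ 3) := hmain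
    _ ≤ _ := by gcongr

/-- The cases not covered by `measureReal_Icc_le`, namely a nonpositive exponent or `σ³ ≤ 2 l`, are
those in which the right-hand side is at least `1`. -/
lemma measureReal_Icc_le_rpow {Ω : Type*} [MeasurableSpace Ω] {Pr : Measure Ω}
    [IsProbabilityMeasure Pr] {v : ℤ → Ω → ℝ} (hv_meas : ∀ i, Measurable (v i))
    (hv_indep : iIndepFun v Pr) {P : Measure ℝ} [IsProbabilityMeasure P]
    (hv_law : ∀ i, Pr.map (v i) = P) {c₀ σ γ : ℝ} (hmean : ∫ x, x ∂P = 0)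
    (hvar : variance (fun x : ℝ => x) P = 1) (hP : ∀ᵐ x ∂P, |x| ≤ c₀) (hγ : 0 < γ) (hσ : 0 < σ)
    (hσ1 : σ ≤ 1) {μ : Measure ℝ} (hμ : IsIntegratedDensityOfStates Pr v σ μ)
    {l₀ l : ℝ} (hl₀ : l₀ ∈ Set.Ioo (-2 + γ) (-γ) ∪ Set.Ioo γ (2 - γ)) (hl : 0 < l) (hl1 : l ≤ 1) :
    μ.real (Set.Icc l₀ (l₀ + l)) ≤ 2 / σ ^ 3 * l ^ (1 - 460 * c₀ ^ 3 * σ / γ) := by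
  have := hμ.1
  have hc₀ := one_le_of_variance_eq_one hmean hvar hP
  have hA0 : 0 ≤ c₀ ^ 3 * σ / γ := by positivity
  have e1 : 460 * c₀ ^ 3 * σ / γ = 460 * (c₀ ^ 3 * σ / γ) := by ring
  have e2 : 230 * c₀ ^ 3 * σ / γ = 230 * (c₀ ^ 3 * σ / γ) := by ring
  have hσ3 : σ ^ 3 ≤ 1 := pow_le_one₀ hσ.le hσ1
  have hσ30 : 0 < σ ^ 3 := by positivity
  have hμ1 : μ.real (Set.Icc l₀ (l₀ + l)) ≤ 1 := measureReal_le_one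
  rcases le_or_gt 1 (460 * c₀ ^ 3 * σ / γ) with hA | hA
  · have h1 : 1 ≤ l ^ (1 - 460 * c₀ ^ 3 * σ / γ) :=
      Real.one_le_rpow_of_pos_of_le_one_of_nonpos hl hl1 (by linarith)
    have h2 : 1 ≤ 2 / σ ^ 3 := by rw [le_div_iff₀ hσ30]; linarith
    nlinarith
  have hl2 : l ≤ l ^ (1 - 460 * c₀ ^ 3 * σ / γ) := by
    calc l = l ^ (1 : ℝ) := (Real.rpow_one _).symm
      _ ≤ _ := Real.rpow_le_rpow_of_exponent_ge hl hl1 (by rw [e1]; linarith)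
  rcases le_or_gt (σ ^ 3 / 2) l with hlσ | hlσ
  · calc _ ≤ 1 := hμ1
      _ = 2 / σ ^ 3 * (σ ^ 3 / 2) := by field_simp
      _ ≤ _ := by
        gcongr
        exact hlσ.trans hl2
  · refine (measureReal_Icc_le hv_meas hv_indep hv_law hmean hvar hP hγ hσ hA hμ hl₀ hl hlσ).trans ?_
    rw [e1] at hA
    have h1 : (2 * l) ^ (1 - 230 * c₀ ^ 3 * σ / γ) ≤ 2 * l ^ (1 - 460 * c₀ ^ 3 * σ / γ) := by
      rw [Real.mul_rpow zero_le_two hl.le]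
      refine mul_le_mul ?_ ?_ (by positivity) zero_le_two
      · calc (2 : ℝ) ^ (1 - 230 * c₀ ^ 3 * σ / γ) ≤ 2 ^ (1 : ℝ) :=
            Real.rpow_le_rpow_of_exponent_le one_le_two (by rw [e2]; linarith)
          _ = 2 := Real.rpow_one _
      · exact Real.rpow_le_rpow_of_exponent_ge hl hl1 (by rw [e1, e2]; linarith)
    have h3 : 0 < l ^ (1 - 460 * c₀ ^ 3 * σ / γ) := by positivity
    calc _ ≤ 2 * l ^ (1 - 460 * c₀ ^ 3 * σ / γ) / (2 * σ ^ 3) := by gcongr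
      _ = 1 / σ ^ 3 * l ^ (1 - 460 * c₀ ^ 3 * σ / γ) := by field_simp
      _ ≤ _ := by gcongr; norm_num

/-! ### Hölder continuity -/

lemma cdf_sub_le_measureReal_Icc (μ : Measure ℝ) [IsProbabilityMeasure μ] {x y : ℝ} (hxy : x ≤ y) :
    cdf μ y - cdf μ x ≤ μ.real (Set.Icc x y) := by
  have hd : Disjoint (Set.Iic x) (Set.Ioc x y) :=
    Set.disjoint_left.mpr fun z hz hz' => not_lt.mpr (Set.mem_Iic.mp hz) hz'.1
  rw [cdf_eq_real, cdf_eq_real, ← Set.Iic_union_Ioc_eq_Iic hxy,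
    measureReal_union hd measurableSet_Ioc, add_sub_cancel_left]
  exact measureReal_mono Set.Ioc_subset_Icc_self

/-- A power bound on the mass of short intervals makes the distribution function Hölder continuous. -/
lemma holderOnWith_cdf {μ : Measure ℝ} [IsProbabilityMeasure μ] {s : Set ℝ} {C α : ℝ≥0}
    (hC : 1 ≤ C) (h : ∀ x ∈ s, ∀ l : ℝ, 0 < l → l ≤ 1 →
      μ.real (Set.Icc x (x + l)) ≤ C * l ^ (α : ℝ)) :
    HolderOnWith C α (cdf μ) s := by
  have key : ∀ x ∈ s, ∀ y, x < y → cdf μ y - cdf μ x ≤ C * (y - x) ^ (α : ℝ) := by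
    intro x hx y hxy
    have hC' : (1 : ℝ) ≤ C := hC
    rcases le_or_gt (y - x) 1 with h1 | h1
    · refine (cdf_sub_le_measureReal_Icc μ hxy.le).trans ?_
      simpa using h x hx (y - x) (sub_pos.mpr hxy) h1
    · have h2 : 1 ≤ (y - x) ^ (α : ℝ) := Real.one_le_rpow h1.le α.2
      have h3 := cdf_le_one μ y
      have h4 := cdf_nonneg μ x
      nlinarith
  have hdist : ∀ x ∈ s, ∀ y ∈ s, dist (cdf μ x) (cdf μ y) ≤ C * dist x y ^ (α : ℝ) := by
    intro x hx y hy
    rcases lt_trichotomy x y with hxy | rfl | hxy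
    · rw [dist_comm, dist_comm x, Real.dist_eq, Real.dist_eq, abs_of_pos (sub_pos.mpr hxy),
        abs_of_nonneg (sub_nonneg.mpr (monotone_cdf μ hxy.le))]
      exact key x hx y hxy
    · rw [dist_self]; positivity
    · rw [Real.dist_eq, Real.dist_eq, abs_of_pos (sub_pos.mpr hxy),
        abs_of_nonneg (sub_nonneg.mpr (monotone_cdf μ hxy.le))]
      exact key y hy x hxy
  intro x hx y hy
  have h1 := hdist x hx y hy
  rw [edist_nndist, edist_nndist, ← ENNReal.coe_rpow_of_nonneg _ α.coe_nonneg]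
  refine mod_cast h1

theorem theorem1 {Ω : Type*} [MeasurableSpace Ω] (Pr : Measure Ω) [IsProbabilityMeasure Pr]
    (v : ℤ → Ω → ℝ) (hv_meas : ∀ i, Measurable (v i)) (hv_indep : iIndepFun v Pr)
    (P : Measure ℝ) [IsProbabilityMeasure P] (hv_law : ∀ i, Pr.map (v i) = P)
    (c₀ : ℝ) (hP_mean : ∫ x, x ∂P = 0) (hP_var : variance (fun x : ℝ => x) P = 1)
    (hP_bdd : ∀ᵐ x ∂P, |x| ≤ c₀)
    (γ : ℝ) (hγ : 0 < γ) (σ : ℝ) (hσ : 0 < σ) (hσ1 : σ ≤ 1) :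
    (∃ μ : Measure ℝ, IsIntegratedDensityOfStates Pr v σ μ) ∧
    ∀ μ : Measure ℝ, IsIntegratedDensityOfStates Pr v σ μ →
      (∀ l₀ ∈ Set.Ioo (-2 + γ) (-γ) ∪ Set.Ioo γ (2 - γ), ∀ l : ℝ, 0 < l → l ≤ 1 →
        μ.real (Set.Icc l₀ (l₀ + l)) ≤ 2 / σ ^ 3 * l ^ (1 - 460 * c₀ ^ 3 * σ / γ)) ∧
      (∀ α : ℝ≥0, (α : ℝ) = 1 - 460 * c₀ ^ 3 * σ / γ →
        ∃ C : ℝ≥0, HolderOnWith C α (cdf μ) (Set.Ioo (-2 + γ) (-γ) ∪ Set.Ioo γ (2 - γ))) := by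
  refine ⟨exists_isIntegratedDensityOfStates hv_meas hv_indep hv_law hσ.le hP_bdd, fun μ hμ => ?_⟩
  have := hμ.1
  have hbound := fun l₀ hl₀ l hl hl1 => measureReal_Icc_le_rpow hv_meas hv_indep hv_law hP_mean
    hP_var hP_bdd hγ hσ hσ1 hμ (l₀ := l₀) hl₀ (l := l) hl hl1
  refine ⟨hbound, fun α hα => ⟨Real.toNNReal (2 / σ ^ 3), holderOnWith_cdf ?_ ?_⟩⟩
  · rw [Real.one_le_toNNReal, le_div_iff₀ (by positivity)]
    have := pow_le_one₀ (n := 3) hσ.le hσ1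
    linarith
  · intro x hx l hl hl1
    rw [hα, Real.coe_toNNReal _ (by positivity)]
    exact hbound x hx l hl hl1
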